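/- For $\theta\ge 0$, $t\in[0,1]$, $K\in\mathbb{R}$ and $n>0$ let $$\sigma^{(t)}_{K,n}(\theta)=\begin{cases}\infty & K\theta^2\ge n\pi^2,\\ \dfrac{\sin(t\theta\sqrt{K/n})}{\sin(\theta\sqrt{K/n})} & 0<K\theta^2<n\pi^2,\\ t & K\theta^2=0,\\ \dfrac{\sinh(t\theta\sqrt{-K/n})}{\sinh(\theta\sqrt{-K/n})} & K\theta^2<0.\end{cases}$$ For $K\in\mathbb{R}$, $N\ge 1$ and $a<b$ consider Borel probability measures $\mu=h\,\mathcal{L}^1$ on $\mathbb{R}$ that are concentrated on $[a,b]$, with density $h\ge 0$. Let $\mathcal{F}^s_{K,N}[a,b]$ be the set of those for which, if $N>1$, $h$ can be chosen continuous on $[a,b]$ with $$h((1-s)t_0+st_1)^{\frac1{N-1}}\ \ge\ \sigma^{(1-s)}_{K,N-1}(t_1-t_0)\,h(t_0)^{\frac1{N-1}}+\sigma^{(s)}_{K,N-1}(t_1-t_0)\,h(t_1)^{\frac1{N-1}}$$ for all $s\in[0,1]$ and all $t_0<t_1$ in $[a,b]$ (with $\infty\cdot 0=0$), and, if $N=1$,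 $h$ is constant on $[a,b]$. Let $\mathcal{F}_{K,N}[a,b]$ be the set of those for which, if $N>1$, $h$ can be chosen in $C^2((a,b))$ with $h^{\frac1{N-1}}$ twice differentiable and $$\big(h^{\frac{1}{N-1}}\big)''+\tfrac{K}{N-1}\,h^{\frac1{N-1}}\le 0\quad\text{on }(a,b),$$ and, if $N=1$, $h$ is constant on $(a,b)$. For $D>0$ let $\mathcal{F}^s_{K,N,D}$ and $\mathcal{F}_{K,N,D}$ be the unions of the sets $\mathcal{F}^s_{K,N}[a,b]$, respectively $\mathcal{F}_{K,N}[a,b]$, over all $0\le a<b\le D$ (densities on an interval contained in $[0,D]$). For $p\in(1,\infty)$ and a set $\mathcal{F}$ of such measures put $$\lambda^{1,p}(\mathcal{F})=\inf_{\mu\in\mathcal{F}}\ \inf\left\{\frac{\int_{\mathbb{R}}|u'|^p\,d\mu}{\int_{\mathbb{R}}|u|^p\,d\mu}\ :\ u\in \mathrm{Lip}(\mathbb{R})\cap L^p(\mu),\ \int_{\mathbb{R}}u|u|^{p-2}\,d\mu=0,\ u\ne 0 \text{ in } L^p(\mu)\right\}\in[0,\infty],$$ with $\inf\emptyset=\infty$.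 Then for every $p\in(1,\infty)$, $N\in[1,\infty)$, $K\in\mathbb{R}$ and $D\in(0,\infty)$ the synthetic and the smooth model eigenvalues coincide: $$\lambda^{1,p}(\mathcal{F}^s_{K,N,D})=\lambda^{1,p}(\mathcal{F}_{K,N,D}).$$ The same equality holds when the conditions are imposed on the whole of $[0,D]$, that is, $$\lambda^{1,p}(\mathcal{F}^s_{K,N}[0,D])=\lambda^{1,p}(\mathcal{F}_{K,N}[0,D]).$$ -/

import Mathlib

open MeasureTheory Set
open scoped ENNReal

noncomputable section

namespace ModelGap

/-- The distortion coefficient `σ_{K,N}^{(t)}(θ)`, with values in `[0,∞]`. -/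
def sigma (K N t θ : ℝ) : ℝ≥0∞ :=
  if N * Real.pi ^ 2 ≤ K * θ ^ 2 then ⊤
  else if 0 < K * θ ^ 2 then
    ENNReal.ofReal (Real.sin (t * θ * √(K / N)) / Real.sin (θ * √(K / N)))
  else if K * θ ^ 2 = 0 ∨ N = 0 then ENNReal.ofReal t
  else ENNReal.ofReal (Real.sinh (t * θ * √(-K / N)) / Real.sinh (θ * √(-K / N)))

/-- The weak `(K,N)`-concavity of `h` on the interval `[a,b]` (used for `N > 1`). The inequality is
between elements of `[0,∞]`, with the convention `∞ * 0 = 0`. -/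
def WeakConcave (K N a b : ℝ) (h : ℝ → ℝ) : Prop :=
  ∀ t₀ ∈ Icc a b, ∀ t₁ ∈ Icc a b, t₀ < t₁ → ∀ s ∈ Icc (0 : ℝ) 1,
    sigma K (N - 1) (1 - s) (t₁ - t₀) * ENNReal.ofReal (h t₀ ^ (1 / (N - 1)))
        + sigma K (N - 1) s (t₁ - t₀) * ENNReal.ofReal (h t₁ ^ (1 / (N - 1)))
      ≤ ENNReal.ofReal (h ((1 - s) * t₀ + s * t₁) ^ (1 / (N - 1)))

/-- The differential inequality `(h^{1/(N-1)})'' + K/(N-1) h^{1/(N-1)} ≤ 0` on the open interval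
`(a,b)` (used for `N > 1`); it includes that the second derivative exists at every point. -/
def SmoothConcave (K N a b : ℝ) (h : ℝ → ℝ) : Prop :=
  DifferentiableOn ℝ (fun t => h t ^ (1 / (N - 1))) (Ioo a b) ∧
  DifferentiableOn ℝ (deriv fun t => h t ^ (1 / (N - 1))) (Ioo a b) ∧
  ∀ t ∈ Ioo a b,
    deriv (deriv fun t => h t ^ (1 / (N - 1))) t + K / (N - 1) * h t ^ (1 / (N - 1)) ≤ 0

/-- The measure `h · 𝓛¹` carried by the interval `[a,b]`. -/
def densityMeasure (a b : ℝ) (h : ℝ → ℝ) : Measure ℝ :=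
  (volume.restrict (Icc a b)).withDensity fun t => ENNReal.ofReal (h t)

/-- Probability measures `h · 𝓛¹` on `[a,b]` whose density is continuous and weakly
`(K,N)`-concave on `[a,b]` if `N > 1`, and constant on `[a,b]` if `N = 1`. -/
def syntheticOn (K N a b : ℝ) : Set (Measure ℝ) :=
  {μ | IsProbabilityMeasure μ ∧ ∃ h : ℝ → ℝ, μ = densityMeasure a b h ∧
    (∀ t ∈ Icc a b, 0 ≤ h t) ∧
    (1 < N → ContinuousOn h (Icc a b) ∧ WeakConcave K N a b h) ∧
    (N = 1 → ∃ c, ∀ t ∈ Icc a b, h t = c)}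

/-- Probability measures `h · 𝓛¹` on `[a,b]` whose density is `C²` on `(a,b)` and satisfies the
differential inequality there if `N > 1`, and is constant on `(a,b)` if `N = 1`. -/
def smoothOn (K N a b : ℝ) : Set (Measure ℝ) :=
  {μ | IsProbabilityMeasure μ ∧ ∃ h : ℝ → ℝ, μ = densityMeasure a b h ∧
    (∀ t ∈ Ioo a b, 0 ≤ h t) ∧
    (1 < N → ContDiffOn ℝ 2 h (Ioo a b) ∧ SmoothConcave K N a b h) ∧
    (N = 1 → ∃ c, ∀ t ∈ Ioo a b, h t = c)}

/-- The synthetic class: the support is an interval contained in `[0,D]`. -/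
def synthetic (K N D : ℝ) : Set (Measure ℝ) :=
  {μ | ∃ a b, 0 ≤ a ∧ a < b ∧ b ≤ D ∧ μ ∈ syntheticOn K N a b}

/-- The smooth class: the support is an interval contained in `[0,D]`. -/
def smooth (K N D : ℝ) : Set (Measure ℝ) :=
  {μ | ∃ a b, 0 ≤ a ∧ a < b ∧ b ≤ D ∧ μ ∈ smoothOn K N a b}

/-- The competitors `u ∈ Lip(ℝ) ∩ L^p(μ)`, `∫ u |u|^{p-2} dμ = 0`, `u ≠ 0` in `L^p(μ)`. -/
def Admissible (p : ℝ) (μ : Measure ℝ) (u : ℝ → ℝ) : Prop :=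
  (∃ L, LipschitzWith L u) ∧ MemLp u (ENNReal.ofReal p) μ ∧
    ∫ x, u x * |u x| ^ (p - 2) ∂μ = 0 ∧ ¬ u =ᵐ[μ] 0

/-- The quotient `∫ |u'|^p dμ / ∫ |u|^p dμ`. -/
def rayleigh (p : ℝ) (μ : Measure ℝ) (u : ℝ → ℝ) : ℝ≥0∞ :=
  (∫⁻ x, ENNReal.ofReal (|deriv u x| ^ p) ∂μ) / ∫⁻ x, ENNReal.ofReal (|u x| ^ p) ∂μ

/-- The infimum of the quotients over a class of measures and all their competitors, in `[0,∞]`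
(the infimum of the empty set is `∞`). -/
def eigenvalue (p : ℝ) (F : Set (Measure ℝ)) : ℝ≥0∞ :=
  ⨅ μ ∈ F, ⨅ (u : ℝ → ℝ) (_ : Admissible p μ u), rayleigh p μ u

end ModelGap

end

/-!
The two classes of densities are compared on a fixed interval `[a, b]`. For `N = 1` they coincide.
For `N > 1` put `k = K / (N - 1)` and `f = h ^ (1 / (N - 1))`. Up to regularity and boundary values,
both conditions on `h` say that `f` lies above every solution of `y'' + k y = 0` interpolating it at
two nearby points (`InterpConcave`).

*Smooth densities are synthetic* (`smoothOn_subset_syntheticOn`). The Wronskian of `f` with a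
positive solution of `y'' + k y = 0` decreases, so the ratio of `f` minus its interpolant to that
solution first increases and then decreases; this gives interpolation concavity on `(a, b)`
(`interpConcave_of_deriv`). The same monotonicity produces limits of `f` at both ends, hence a
continuous extension of `h` that is weakly concave on `[a, b]` and defines the same measure.
Positivity of `f` in the interior and the bound `k (b - a) ^ 2 ≤ π ^ 2` on the length
(`InterpConcave.pos_of_pos`, `InterpConcave.length_le`) control the infinite values of `sigma`.

*Synthetic densities are limits of smooth ones* (`eigenvalue_smoothOn_le_rayleigh`). If
`k (b - a) ^ 2 = π ^ 2`, then `f` is a multiple of the generalized sine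
(`InterpConcave.eq_const_mul_sn`) and there is nothing to approximate. Otherwise there is a solution
`φ = posSol k a b` that is positive on all of `[a, b]`, and a coordinate `τ = affineCoord k a b` from
`[a, b]` onto `[0, 1]`, the quotient of another solution by `φ`. In it the solutions become `φ` times
affine functions, so that `f = φ · G(τ)` with `G` concave and continuous on `[0, 1]`. Bernstein
polynomials of a concave function are concave and converge uniformly, so replacing `G` by them gives
smooth approximations of `f` on the same interval that satisfy the differential inequality
(`InterpConcave.exists_smooth_approximation`); no mollification near the ends is needed.

Finally the quotient passes to the limit (`eigenvalue_le_rayleigh_of_tendsto`). For the approximating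
measures a competitor `u` violates the constraint `∫ u |u|^{p-2} = 0`, but because `x ↦ x |x|^{p-2}`
is strictly increasing, it is restored by adding constants that tend to zero
(`exists_shift_tendsto_zero`), and dominated convergence does the rest.
-/

namespace ModelGap

/-! ### Generalized sine and cosine -/

/-- The solution of `y'' + k y = 0` with `y(0) = 0`, `y'(0) = 1`. -/
noncomputable def sn (k x : ℝ) : ℝ :=
  if 0 < k then Real.sin (√k * x) / √k
  else if k = 0 then x else Real.sinh (√(-k) * x) / √(-k)

/-- The solution of `y'' + k y = 0` with `y(0) = 1`, `y'(0) = 0`. -/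
noncomputable def cs (k x : ℝ) : ℝ :=
  if 0 < k then Real.cos (√k * x) else if k = 0 then 1 else Real.cosh (√(-k) * x)

lemma sn_zero (k : ℝ) : sn k 0 = 0 := by simp [sn]

lemma cs_zero (k : ℝ) : cs k 0 = 1 := by simp [cs]

lemma sn_neg (k x : ℝ) : sn k (-x) = -sn k x := by
  unfold sn; split_ifs <;> simp [neg_div]

lemma cs_neg (k x : ℝ) : cs k (-x) = cs k x := by
  unfold cs; split_ifs <;> simp

lemma sn_add (k x y : ℝ) : sn k (x + y) = sn k x * cs k y + cs k x * sn k y := by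
  unfold sn cs; split_ifs
  · rw [mul_add, Real.sin_add]; ring
  · ring
  · rw [mul_add, Real.sinh_add]; ring

lemma cs_add (k x y : ℝ) : cs k (x + y) = cs k x * cs k y - k * (sn k x * sn k y) := by
  unfold sn cs; split_ifs with h h'
  · have h1 : √k ^ 2 = k := Real.sq_sqrt h.le
    have h2 : √k ≠ 0 := (Real.sqrt_pos.2 h).ne'
    rw [mul_add, Real.cos_add]; field_simp; rw [h1]; ring
  · simp [h']
  · have h0 : 0 < -k := by
      rcases lt_trichotomy k 0 with h1 | h1 | h1 <;> first | linarith | contradiction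
    have h1 : √(-k) ^ 2 = -k := Real.sq_sqrt h0.le
    have h2 : √(-k) ≠ 0 := (Real.sqrt_pos.2 h0).ne'
    rw [mul_add, Real.cosh_add]; field_simp; rw [h1]; ring

lemma cs_sq_add (k x : ℝ) : cs k x ^ 2 + k * sn k x ^ 2 = 1 := by
  have h := cs_add k x (-x)
  rw [add_neg_cancel, cs_zero, cs_neg, sn_neg] at h
  linarith

lemma hasDerivAt_sn (k x : ℝ) : HasDerivAt (sn k) (cs k x) x := by
  unfold sn cs; split_ifs with h h'
  · have h2 : √k ≠ 0 := (Real.sqrt_pos.2 h).ne'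
    convert! (((hasDerivAt_id x).const_mul (√k)).sin.div_const (√k)) using 1
    simp; field_simp
  · exact hasDerivAt_id x
  · have h0 : 0 < -k := by
      rcases lt_trichotomy k 0 with h1 | h1 | h1 <;> first | linarith | contradiction
    have h2 : √(-k) ≠ 0 := (Real.sqrt_pos.2 h0).ne'
    convert! (((hasDerivAt_id x).const_mul (√(-k))).sinh.div_const (√(-k))) using 1
    simp; field_simp

lemma hasDerivAt_cs (k x : ℝ) : HasDerivAt (cs k) (-k * sn k x) x := by
  unfold sn cs; split_ifs with h h'
  · have h1 : √k * √k = k := Real.mul_self_sqrt h.le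
    have h2 : √k ≠ 0 := (Real.sqrt_pos.2 h).ne'
    convert! (((hasDerivAt_id x).const_mul (√k)).cos) using 1
    simp; field_simp; linear_combination -Real.sin (√k * x) * h1
  · simpa [h'] using hasDerivAt_const x (1 : ℝ)
  · have h0 : 0 < -k := by
      rcases lt_trichotomy k 0 with h1 | h1 | h1 <;> first | linarith | contradiction
    have h1 : √(-k) * √(-k) = -k := Real.mul_self_sqrt h0.le
    have h2 : √(-k) ≠ 0 := (Real.sqrt_pos.2 h0).ne'
    convert! (((hasDerivAt_id x).const_mul (√(-k))).cosh) using 1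
    simp; field_simp; linear_combination -Real.sinh (√(-k) * x) * h1

lemma contDiff_sn (k : ℝ) {n : WithTop ℕ∞} : ContDiff ℝ n (sn k) := by
  unfold sn; split_ifs
  · fun_prop
  · fun_prop
  · fun_prop

lemma continuous_sn (k : ℝ) : Continuous (sn k) :=
  (contDiff_sn k (n := 0)).continuous

/-- For `k > 0` the hypothesis says that `x` lies before the first positive zero `π / √k`. -/
lemma sn_pos {k x : ℝ} (hx : 0 < x) (hk : k * x ^ 2 < Real.pi ^ 2) : 0 < sn k x := by
  unfold sn; split_ifs with h h'
  · have h2 : 0 < √k := Real.sqrt_pos.2 h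
    refine div_pos (Real.sin_pos_of_pos_of_lt_pi (by positivity) ?_) h2
    refine lt_of_pow_lt_pow_left₀ 2 Real.pi_pos.le ?_
    rwa [mul_pow, Real.sq_sqrt h.le]
  · exact hx
  · have h0 : 0 < -k := by
      rcases lt_trichotomy k 0 with h1 | h1 | h1 <;> first | linarith | contradiction
    have h2 : 0 < √(-k) := Real.sqrt_pos.2 h0
    exact div_pos (Real.sinh_pos_iff.2 (by positivity)) h2

lemma sn_nonneg {k x : ℝ} (hx : 0 ≤ x) (hk : k * x ^ 2 < Real.pi ^ 2) : 0 ≤ sn k x := by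
  rcases hx.eq_or_lt with rfl | h
  · rw [sn_zero]
  · exact (sn_pos h hk).le

/-- `k d ^ 2 < π ^ 2` is inherited by smaller distances. -/
lemma mul_sq_lt_of_le {k c x d : ℝ} (hc : 0 < c) (hx : 0 ≤ x) (hxd : x ≤ d) (hk : k * d ^ 2 < c) :
    k * x ^ 2 < c := by
  rcases le_or_gt k 0 with h | h
  · nlinarith [sq_nonneg x]
  · have : x ^ 2 ≤ d ^ 2 := pow_le_pow_left₀ hx hxd 2
    nlinarith

lemma sn_sub_of_mul_sq_eq {k L : ℝ} (hL : 0 < L) (hk : k * L ^ 2 = Real.pi ^ 2) (x : ℝ) :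
    sn k (L - x) = sn k x := by
  have hk0 : 0 < k := by
    by_contra h
    have := Real.pi_pos
    nlinarith [sq_nonneg L, pow_pos this 2]
  have h1 : √k * L = Real.pi := by
    rw [← Real.sqrt_sq hL.le, ← Real.sqrt_mul hk0.le, hk, Real.sqrt_sq Real.pi_pos.le]
  simp only [sn, if_pos hk0, mul_sub, h1, Real.sin_pi_sub]

/-- Every translate of `sn k` solves `y'' + k y = 0`, so it is interpolated exactly by its values
at two points. -/
lemma sn_interpolation (k a x y z : ℝ) :
    sn k (z - y) * sn k (x - a) + sn k (y - x) * sn k (z - a) = sn k (z - x) * sn k (y - a) := by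
  have e1 : z - a = (x - a) + ((y - x) + (z - y)) := by ring
  have e2 : z - x = (y - x) + (z - y) := by ring
  have e3 : y - a = (x - a) + (y - x) := by ring
  rw [e1, e2, e3]
  generalize x - a = r
  generalize y - x = p
  generalize z - y = q
  simp only [sn_add, cs_add]
  linear_combination -sn k q * sn k r * cs_sq_add k p

/-- A solution of `y'' + k y = 0` that is positive on `[a, b]` as long as `b - a` is below the
first positive zero of `sn k`. -/
noncomputable def posSol (k a b t : ℝ) : ℝ := sn k (b - t) + sn k (t - a)

/-- The derivative of `posSol`. -/
noncomputable def posSolDeriv (k a b t : ℝ) : ℝ := -cs k (b - t) + cs k (t - a)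

lemma hasDerivAt_sn_sub (k a t : ℝ) : HasDerivAt (fun t => sn k (t - a)) (cs k (t - a)) t :=
  (hasDerivAt_sn k (t - a)).comp_sub_const t a

lemma hasDerivAt_cs_sub (k a t : ℝ) :
    HasDerivAt (fun t => cs k (t - a)) (-k * sn k (t - a)) t :=
  (hasDerivAt_cs k (t - a)).comp_sub_const t a

lemma sn_sub_comm (k a b : ℝ) : sn k (a - b) = -sn k (b - a) := by rw [← sn_neg, neg_sub]

lemma cs_sub_comm (k a b : ℝ) : cs k (a - b) = cs k (b - a) := by rw [← cs_neg, neg_sub]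

lemma hasDerivAt_posSol (k a b t : ℝ) :
    HasDerivAt (posSol k a b) (posSolDeriv k a b t) t := by
  have h := (hasDerivAt_sn_sub k b t).neg.add (hasDerivAt_sn_sub k a t)
  convert! h using 1
  · funext s; simp [posSol, sn_sub_comm k b s]
  · simp [posSolDeriv, cs_sub_comm k b t]

lemma hasDerivAt_posSolDeriv (k a b t : ℝ) :
    HasDerivAt (posSolDeriv k a b) (-k * posSol k a b t) t := by
  have h := (hasDerivAt_cs_sub k b t).neg.add (hasDerivAt_cs_sub k a t)
  convert! h using 1
  · funext s; simp [posSolDeriv, cs_sub_comm k b s]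
  · simp only [posSol, sn_sub_comm k b t]; ring

lemma posSol_pos {k a b t : ℝ} (hab : a < b) (hk : k * (b - a) ^ 2 < Real.pi ^ 2)
    (ht : t ∈ Icc a b) : 0 < posSol k a b t := by
  have hpi : (0 : ℝ) < Real.pi ^ 2 := by positivity
  have h1 : 0 ≤ sn k (b - t) :=
    sn_nonneg (by linarith [ht.2]) (mul_sq_lt_of_le hpi (by linarith [ht.2]) (by linarith [ht.1]) hk)
  have h2 : k * (t - a) ^ 2 < Real.pi ^ 2 :=
    mul_sq_lt_of_le hpi (by linarith [ht.1]) (by linarith [ht.2]) hk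
  rcases ht.1.eq_or_lt with rfl | h
  · have := sn_pos (sub_pos.2 hab) hk
    simpa [posSol, sn_zero] using this
  · have := sn_pos (sub_pos.2 h) h2
    unfold posSol; linarith

lemma posSol_interpolation (k a b x y z : ℝ) :
    sn k (z - y) * posSol k a b x + sn k (y - x) * posSol k a b z
      = sn k (z - x) * posSol k a b y := by
  simp only [posSol, sn_sub_comm k b]
  linear_combination sn_interpolation k a x y z - sn_interpolation k b x y z

/-- The Wronskian of `posSol k a b` and `sn k (· - a)` is constant. -/
lemma posSol_wronskian (k a b t : ℝ) :
    cs k (t - a) * posSol k a b t - sn k (t - a) * posSolDeriv k a b t = sn k (b - a) := by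
  have e : b - a = (b - t) + (t - a) := by ring
  rw [e, sn_add, posSol, posSolDeriv]; ring

/-! ### Sturm comparison for the differential inequality -/

/-- The Wronskian of `f` and a nonnegative solution of `y'' + k y = 0` decreases when
`f'' + k f ≤ 0`. -/
lemma wronskian_antitoneOn {k : ℝ} {f f' f'' φ φ' : ℝ → ℝ} {J : Set ℝ} (hJ : Convex ℝ J)
    (hf : ∀ t ∈ J, HasDerivAt f (f' t) t) (hf' : ∀ t ∈ J, HasDerivAt f' (f'' t) t)
    (hle : ∀ t ∈ J, f'' t + k * f t ≤ 0)
    (hφ : ∀ t, HasDerivAt φ (φ' t) t) (hφ' : ∀ t, HasDerivAt φ' (-k * φ t) t)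
    (h0 : ∀ t ∈ J, 0 ≤ φ t) :
    AntitoneOn (fun t => f' t * φ t - f t * φ' t) J := by
  have key : ∀ t ∈ J, HasDerivAt (fun t => f' t * φ t - f t * φ' t)
      ((f'' t + k * f t) * φ t) t := by
    intro t ht
    convert! ((hf' t ht).mul (hφ t)).sub ((hf t ht).mul (hφ' t)) using 1
    ring
  refine antitoneOn_of_deriv_nonpos hJ (fun t ht => (key t ht).continuousAt.continuousWithinAt)
    (fun t ht => (key t (interior_subset ht)).differentiableAt.differentiableWithinAt) ?_
  intro t ht
  rw [(key t (interior_subset ht)).deriv]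
  exact mul_nonpos_of_nonpos_of_nonneg (hle t (interior_subset ht)) (h0 t (interior_subset ht))

lemma ratio_monotoneOn {f f' φ φ' : ℝ → ℝ} {J : Set ℝ} (hJ : Convex ℝ J)
    (hf : ∀ t ∈ J, HasDerivAt f (f' t) t) (hφ : ∀ t, HasDerivAt φ (φ' t) t)
    (h0 : ∀ t ∈ J, 0 < φ t) (hW : ∀ t ∈ J, 0 ≤ f' t * φ t - f t * φ' t) :
    MonotoneOn (fun t => f t / φ t) J := by
  have key : ∀ t ∈ J, HasDerivAt (fun t => f t / φ t)
      ((f' t * φ t - f t * φ' t) / φ t ^ 2) t := fun t ht => (hf t ht).div (hφ t) (h0 t ht).ne'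
  refine monotoneOn_of_deriv_nonneg hJ (fun t ht => (key t ht).continuousAt.continuousWithinAt)
    (fun t ht => (key t (interior_subset ht)).differentiableAt.differentiableWithinAt) ?_
  intro t ht
  rw [(key t (interior_subset ht)).deriv]
  exact div_nonneg (hW t (interior_subset ht)) (sq_nonneg _)

lemma ratio_antitoneOn {f f' φ φ' : ℝ → ℝ} {J : Set ℝ} (hJ : Convex ℝ J)
    (hf : ∀ t ∈ J, HasDerivAt f (f' t) t) (hφ : ∀ t, HasDerivAt φ (φ' t) t)
    (h0 : ∀ t ∈ J, 0 < φ t) (hW : ∀ t ∈ J, f' t * φ t - f t * φ' t ≤ 0) :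
    AntitoneOn (fun t => f t / φ t) J := by
  have h := ratio_monotoneOn (f := fun t => -f t) (f' := fun t => -f' t) hJ
    (fun t ht => (hf t ht).neg) hφ h0 (fun t ht => by have := hW t ht; linarith)
  intro x hx y hy hxy
  have := h hx hy hxy
  simp only [neg_div] at this
  linarith

/-- `f` lies above the solution of `y'' + k y = 0` that interpolates it at any two points of `J`
closer than the first positive zero of `sn k`. -/
def InterpConcave (k : ℝ) (J : Set ℝ) (f : ℝ → ℝ) : Prop :=
  ∀ x ∈ J, ∀ z ∈ J, x < z → k * (z - x) ^ 2 < Real.pi ^ 2 → ∀ y ∈ Icc x z,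
    sn k (z - y) * f x + sn k (y - x) * f z ≤ sn k (z - x) * f y

/-- The difference `w` between `f` and its interpolant vanishes at both ends, and `w / posSol` has
a derivative that changes sign at most once, from plus to minus. -/
lemma interpConcave_of_deriv {k : ℝ} {f f' f'' : ℝ → ℝ} {J : Set ℝ} (hJ : OrdConnected J)
    (hf : ∀ t ∈ J, HasDerivAt f (f' t) t) (hf' : ∀ t ∈ J, HasDerivAt f' (f'' t) t)
    (hle : ∀ t ∈ J, f'' t + k * f t ≤ 0) : InterpConcave k J f := by
  intro x hx z hz hxz hk y hy
  have hsub : Icc x z ⊆ J := hJ.out hx hz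
  set w : ℝ → ℝ := fun t => sn k (z - x) * f t + f x * sn k (t - z) - f z * sn k (t - x) with hw
  set w' : ℝ → ℝ := fun t => sn k (z - x) * f' t + f x * cs k (t - z) - f z * cs k (t - x)
    with hw'
  set w'' : ℝ → ℝ := fun t => sn k (z - x) * f'' t + f x * (-k * sn k (t - z))
    - f z * (-k * sn k (t - x)) with hw''
  have hS : 0 < sn k (z - x) := sn_pos (sub_pos.2 hxz) hk
  have d1 : ∀ t ∈ Icc x z, HasDerivAt w (w' t) t := fun t ht =>
    (((hf t (hsub ht)).const_mul _).add ((hasDerivAt_sn_sub k z t).const_mul _)).sub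
      ((hasDerivAt_sn_sub k x t).const_mul _)
  have d2 : ∀ t ∈ Icc x z, HasDerivAt w' (w'' t) t := fun t ht =>
    (((hf' t (hsub ht)).const_mul _).add ((hasDerivAt_cs_sub k z t).const_mul _)).sub
      ((hasDerivAt_cs_sub k x t).const_mul _)
  have hwle : ∀ t ∈ Icc x z, w'' t + k * w t ≤ 0 := by
    intro t ht
    have h := hle t (hsub ht)
    have e : w'' t + k * w t = sn k (z - x) * (f'' t + k * f t) := by simp only [hw, hw'']; ring
    rw [e]; exact mul_nonpos_of_nonneg_of_nonpos hS.le h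
  have hpos : ∀ t ∈ Icc x z, 0 < posSol k x z t := fun t ht => posSol_pos hxz hk ht
  have anti := wronskian_antitoneOn (convex_Icc x z) d1 d2 hwle (hasDerivAt_posSol k x z)
    (hasDerivAt_posSolDeriv k x z) (fun t ht => (hpos t ht).le)
  have wx : w x = 0 := by simp only [hw, sn_sub_comm k x z, sub_self, sn_zero]; ring
  have wz : w z = 0 := by simp only [hw, sub_self, sn_zero]; ring
  have hwy : 0 ≤ w y := by
    have hy0 := hpos y hy
    rcases le_total 0 (w' y * posSol k x z y - w y * posSolDeriv k x z y) with h | h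
    · have hs : Icc x y ⊆ Icc x z := Icc_subset_Icc_right hy.2
      have := ratio_monotoneOn (convex_Icc x y) (fun t ht => d1 t (hs ht))
        (hasDerivAt_posSol k x z) (fun t ht => hpos t (hs ht))
        (fun t ht => h.trans (anti (hs ht) hy ht.2)) (left_mem_Icc.2 hy.1) (right_mem_Icc.2 hy.1)
        hy.1
      simp only [wx, zero_div] at this
      simpa [hy0.ne'] using mul_nonneg this hy0.le
    · have hs : Icc y z ⊆ Icc x z := Icc_subset_Icc_left hy.1
      have := ratio_antitoneOn (convex_Icc y z) (fun t ht => d1 t (hs ht))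
        (hasDerivAt_posSol k x z) (fun t ht => hpos t (hs ht))
        (fun t ht => (anti hy (hs ht) ht.1).trans h) (left_mem_Icc.2 hy.2) (right_mem_Icc.2 hy.2)
        hy.2
      simp only [wz, zero_div] at this
      simpa [hy0.ne'] using mul_nonneg this hy0.le
  simp only [hw, sn_sub_comm k y z] at hwy
  linarith

open Filter Topology

/-! ### Bernstein polynomials of concave data -/

/-- The Bernstein polynomial of degree `n` with control values `g 0, …, g n`. -/
noncomputable def bernsteinSum (n : ℕ) (g : ℕ → ℝ) : Polynomial ℝ :=
  ∑ j ∈ Finset.range (n + 1), Polynomial.C (g j) * bernsteinPolynomial ℝ n j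

lemma derivative_bernsteinSum (n : ℕ) (g : ℕ → ℝ) :
    (bernsteinSum (n + 1) g).derivative
      = Polynomial.C ((n : ℝ) + 1) * bernsteinSum n (fun j => g (j + 1) - g j) := by
  have h1 : ∑ j ∈ Finset.range (n + 1), Polynomial.C (g (j + 1)) * bernsteinPolynomial ℝ n (j + 1)
      + Polynomial.C (g 0) * bernsteinPolynomial ℝ n 0
      = ∑ j ∈ Finset.range (n + 1), Polynomial.C (g j) * bernsteinPolynomial ℝ n j := by
    rw [← Finset.sum_range_succ' (fun j => Polynomial.C (g j) * bernsteinPolynomial ℝ n j),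
      Finset.sum_range_succ, bernsteinPolynomial.eq_zero_of_lt ℝ (Nat.lt_succ_self n)]
    simp
  have h2 : ∀ j, (bernsteinPolynomial ℝ (n + 1) (j + 1)).derivative = Polynomial.C ((n : ℝ) + 1)
      * (bernsteinPolynomial ℝ n j - bernsteinPolynomial ℝ n (j + 1)) := by
    intro j
    simp [bernsteinPolynomial.derivative_succ]
  have h3 : (bernsteinPolynomial ℝ (n + 1) 0).derivative
      = -Polynomial.C ((n : ℝ) + 1) * bernsteinPolynomial ℝ n 0 := by
    simp [bernsteinPolynomial.derivative_zero]
  unfold bernsteinSum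
  rw [Polynomial.derivative_sum, Finset.sum_range_succ']
  simp only [Polynomial.derivative_C_mul, h2, h3, Polynomial.C_sub, sub_mul,
    Finset.sum_sub_distrib, mul_sub]
  rw [← h1, mul_add, Finset.mul_sum, Finset.mul_sum]
  have e : ∀ i, Polynomial.C (g (i + 1)) * (Polynomial.C ((n : ℝ) + 1) * bernsteinPolynomial ℝ n i)
      = Polynomial.C ((n : ℝ) + 1) * (Polynomial.C (g (i + 1)) * bernsteinPolynomial ℝ n i) :=
    fun i => by ring
  have e' : ∀ i, Polynomial.C (g (i + 1))
        * (Polynomial.C ((n : ℝ) + 1) * bernsteinPolynomial ℝ n (i + 1))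
      = Polynomial.C ((n : ℝ) + 1) * (Polynomial.C (g (i + 1)) * bernsteinPolynomial ℝ n (i + 1)) :=
    fun i => by ring
  simp only [e, e']
  ring

lemma eval_bernsteinSum (n : ℕ) (g : ℕ → ℝ) (x : ℝ) :
    (bernsteinSum n g).eval x
      = ∑ j ∈ Finset.range (n + 1), g j * ((n.choose j : ℝ) * x ^ j * (1 - x) ^ (n - j)) := by
  simp [bernsteinSum, Polynomial.eval_finsetSum, bernsteinPolynomial]

lemma eval_bernsteinSum_nonneg {n : ℕ} {g : ℕ → ℝ} (hg : ∀ j ≤ n, 0 ≤ g j) {x : ℝ}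
    (hx : x ∈ Icc (0 : ℝ) 1) : 0 ≤ (bernsteinSum n g).eval x := by
  rw [eval_bernsteinSum]
  refine Finset.sum_nonneg fun j hj => ?_
  have h1 := hg j (Nat.lt_succ_iff.1 (Finset.mem_range.1 hj))
  have h2 := hx.1
  have h3 : 0 ≤ 1 - x := by linarith [hx.2]
  positivity

lemma eval_bernsteinSum_pos {n : ℕ} {g : ℕ → ℝ} (hg : ∀ j ≤ n, 0 ≤ g j) {i : ℕ} (hi : i ≤ n)
    (hgi : 0 < g i) {x : ℝ} (hx : x ∈ Ioo (0 : ℝ) 1) : 0 < (bernsteinSum n g).eval x := by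
  have h2 := hx.1
  have h3 : 0 < 1 - x := by linarith [hx.2]
  rw [eval_bernsteinSum]
  refine Finset.sum_pos' (fun j hj => ?_) ⟨i, Finset.mem_range.2 (Nat.lt_succ_iff.2 hi), ?_⟩
  · have h1 := hg j (Nat.lt_succ_iff.1 (Finset.mem_range.1 hj))
    positivity
  · have : 0 < n.choose i := Nat.choose_pos hi
    positivity

/-- Bernstein polynomials of concave data are concave. -/
lemma eval_derivative_derivative_bernsteinSum_nonpos {n : ℕ} {g : ℕ → ℝ}
    (hg : ∀ j ≤ n, g (j + 2) + g j ≤ 2 * g (j + 1)) {x : ℝ} (hx : x ∈ Icc (0 : ℝ) 1) :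
    (bernsteinSum (n + 2) g).derivative.derivative.eval x ≤ 0 := by
  rw [derivative_bernsteinSum, Polynomial.derivative_C_mul, derivative_bernsteinSum,
    Polynomial.eval_mul, Polynomial.eval_mul, Polynomial.eval_C, Polynomial.eval_C]
  have h : 0 ≤ (bernsteinSum n fun j => -(g (j + 1 + 1) - g (j + 1) - (g (j + 1) - g j))).eval x :=
    eval_bernsteinSum_nonneg (fun j hj => by linarith [hg j hj]) hx
  have e : (bernsteinSum n fun j => g (j + 1 + 1) - g (j + 1) - (g (j + 1) - g j)).eval x
      = -(bernsteinSum n fun j => -(g (j + 1 + 1) - g (j + 1) - (g (j + 1) - g j))).eval x := by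
    simp only [eval_bernsteinSum, neg_mul, Finset.sum_neg_distrib, neg_neg]
  rw [e]
  have h1 : 0 ≤ (((n + 1 : ℕ) : ℝ) + 1) * (((n : ℝ) + 1)
    * (bernsteinSum n fun j => -(g (j + 1 + 1) - g (j + 1) - (g (j + 1) - g j))).eval x) := by
    positivity
  linarith

lemma eval_bernsteinSum_eq_bernsteinApproximation (n : ℕ) (G : C(unitInterval, ℝ))
    (x : unitInterval) :
    (bernsteinSum n fun j => G (projIcc 0 1 zero_le_one ((j : ℝ) / n))).eval (x : ℝ)
      = bernsteinApproximation n G x := by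
  rw [eval_bernsteinSum, bernsteinApproximation.apply, Finset.sum_range]
  refine Finset.sum_congr rfl fun j _ => ?_
  rw [bernstein_apply, smul_eq_mul, mul_comm]
  congr 2
  exact projIcc_of_mem zero_le_one (bernstein.z j).2

/-! ### Smooth approximation of weakly concave functions -/

/-- The coordinate in which the solutions of `y'' + k y = 0`, divided by `posSol k a b`, are the
affine functions; it maps `[a, b]` onto `[0, 1]`. -/
noncomputable def affineCoord (k a b t : ℝ) : ℝ := sn k (t - a) / posSol k a b t

lemma hasDerivAt_affineCoord {k a b t : ℝ} (h : posSol k a b t ≠ 0) :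
    HasDerivAt (affineCoord k a b) (sn k (b - a) / posSol k a b t ^ 2) t := by
  rw [← posSol_wronskian k a b t]
  exact (hasDerivAt_sn_sub k a t).div (hasDerivAt_posSol k a b t) h

lemma affineCoord_left (k a b : ℝ) : affineCoord k a b a = 0 := by simp [affineCoord, sn_zero]

lemma affineCoord_right {k a b : ℝ} (hab : a < b) (hk : k * (b - a) ^ 2 < Real.pi ^ 2) :
    affineCoord k a b b = 1 := by
  have := sn_pos (sub_pos.2 hab) hk
  simp [affineCoord, posSol, sn_zero, this.ne']

lemma continuousOn_affineCoord {k a b : ℝ} (hab : a < b) (hk : k * (b - a) ^ 2 < Real.pi ^ 2) :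
    ContinuousOn (affineCoord k a b) (Icc a b) := fun _ ht =>
  (hasDerivAt_affineCoord (posSol_pos hab hk ht).ne').continuousAt.continuousWithinAt

lemma strictMonoOn_affineCoord {k a b : ℝ} (hab : a < b) (hk : k * (b - a) ^ 2 < Real.pi ^ 2) :
    StrictMonoOn (affineCoord k a b) (Icc a b) := by
  refine strictMonoOn_of_deriv_pos (convex_Icc a b) (continuousOn_affineCoord hab hk) ?_
  intro t ht
  have hφ := posSol_pos hab hk (interior_subset ht)
  have := sn_pos (sub_pos.2 hab) hk
  rw [(hasDerivAt_affineCoord hφ.ne').deriv]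
  positivity

lemma mapsTo_affineCoord {k a b : ℝ} (hab : a < b) (hk : k * (b - a) ^ 2 < Real.pi ^ 2) :
    MapsTo (affineCoord k a b) (Icc a b) (Icc 0 1) := by
  intro t ht
  have h := (strictMonoOn_affineCoord hab hk).monotoneOn
  rw [← affineCoord_left k a b, ← affineCoord_right hab hk]
  exact ⟨h (left_mem_Icc.2 hab.le) ht ht.1, h ht (right_mem_Icc.2 hab.le) ht.2⟩

lemma mapsTo_affineCoord_Ioo {k a b : ℝ} (hab : a < b) (hk : k * (b - a) ^ 2 < Real.pi ^ 2) :
    MapsTo (affineCoord k a b) (Ioo a b) (Ioo 0 1) := by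
  intro t ht
  have h := strictMonoOn_affineCoord hab hk
  have ht' := Ioo_subset_Icc_self ht
  rw [← affineCoord_left k a b, ← affineCoord_right hab hk]
  exact ⟨h (left_mem_Icc.2 hab.le) ht' ht.1, h ht' (right_mem_Icc.2 hab.le) ht.2⟩

/-- `affineCoord` as a homeomorphism of `[a, b]` onto the unit interval. -/
noncomputable def affineCoordHomeo {k a b : ℝ} (hab : a < b)
    (hk : k * (b - a) ^ 2 < Real.pi ^ 2) : Icc a b ≃ₜ unitInterval :=
  Continuous.homeoOfEquivCompactToT2
    (f := Equiv.ofBijective ((mapsTo_affineCoord hab hk).restrict _ _ _) ⟨by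
      rw [MapsTo.restrict_inj]
      exact (strictMonoOn_affineCoord hab hk).injOn, by
      rw [MapsTo.restrict_surjective_iff]
      have h := (continuousOn_affineCoord hab hk).surjOn_Icc (left_mem_Icc.2 hab.le)
        (right_mem_Icc.2 hab.le)
      rwa [affineCoord_left, affineCoord_right hab hk] at h⟩)
    ((continuousOn_affineCoord hab hk).mapsToRestrict (mapsTo_affineCoord hab hk))

lemma coe_affineCoordHomeo {k a b : ℝ} (hab : a < b) (hk : k * (b - a) ^ 2 < Real.pi ^ 2)
    (t : Icc a b) : (affineCoordHomeo hab hk t : ℝ) = affineCoord k a b t := rfl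

/-- In the coordinate `affineCoord`, interpolation concavity is midpoint concavity. -/
lemma InterpConcave.midpoint {k a b : ℝ} (hab : a < b) (hk : k * (b - a) ^ 2 < Real.pi ^ 2)
    {f : ℝ → ℝ} (hf : InterpConcave k (Icc a b) f) {x y z : ℝ} (hx : x ∈ Icc a b)
    (hz : z ∈ Icc a b) (hxy : x < y) (hyz : y < z)
    (hm : affineCoord k a b x + affineCoord k a b z = 2 * affineCoord k a b y) :
    f x / posSol k a b x + f z / posSol k a b z ≤ 2 * (f y / posSol k a b y) := by
  have hy : y ∈ Icc a b := ⟨hx.1.trans hxy.le, hyz.le.trans hz.2⟩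
  have hd : k * (z - x) ^ 2 < Real.pi ^ 2 :=
    mul_sq_lt_of_le (by positivity) (by linarith) (by linarith [hx.1, hz.2]) hk
  have hS : 0 < sn k (z - x) := sn_pos (by linarith) hd
  have key := hf x hx z hz (hxy.trans hyz) hd y ⟨hxy.le, hyz.le⟩
  have i1 := posSol_interpolation k a b x y z
  have i2 := sn_interpolation k a x y z
  have px := posSol_pos hab hk hx
  have py := posSol_pos hab hk hy
  have pz := posSol_pos hab hk hz
  have hlt := strictMonoOn_affineCoord hab hk hx hz (hxy.trans hyz)
  have ex : sn k (x - a) = affineCoord k a b x * posSol k a b x := by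
    rw [affineCoord]; field_simp
  have ey : sn k (y - a) = affineCoord k a b y * posSol k a b y := by
    rw [affineCoord]; field_simp
  have ez : sn k (z - a) = affineCoord k a b z * posSol k a b z := by
    rw [affineCoord]; field_simp
  rw [ex, ey, ez] at i2
  generalize affineCoord k a b x = τx at *
  generalize affineCoord k a b y = τy at *
  generalize affineCoord k a b z = τz at *
  generalize posSol k a b x = φx at *
  generalize posSol k a b y = φy at *
  generalize posSol k a b z = φz at *
  generalize sn k (z - y) = p at *
  generalize sn k (y - x) = q at *
  generalize sn k (z - x) = S at *
  -- Both weights of the interpolation are equal to one half of `S φ(y)`.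
  have hne : τz - τx ≠ 0 := by linarith
  have w1 : 2 * (p * φx) = S * φy := by
    apply mul_right_cancel₀ hne
    linear_combination (2 * τz) * i1 - 2 * i2 + S * φy * hm
  have w2 : 2 * (q * φz) = S * φy := by linear_combination 2 * i1 - w1
  have e1 : p = S * φy / (2 * φx) := by field_simp; linarith
  have e2 : q = S * φy / (2 * φz) := by field_simp; linarith
  rw [e1, e2] at key
  have e3 : S * φy / (2 * φx) * f x + S * φy / (2 * φz) * f z
      = (S * φy / 2) * (f x / φx + f z / φz) := by field_simp
  have e4 : S * f y = (S * φy / 2) * (2 * (f y / φy)) := by field_simp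
  rw [e3, e4] at key
  exact le_of_mul_le_mul_left key (by positivity)

/-- The substitution of a function of `affineCoord` into `posSol`: the operator `y'' + k y` becomes
a positive multiple of the second derivative. -/
lemma deriv_deriv_posSol_mul {k a b : ℝ} (hab : a < b) (hk : k * (b - a) ^ 2 < Real.pi ^ 2)
    (P : Polynomial ℝ) {t : ℝ} (ht : t ∈ Ioo a b) :
    deriv (deriv fun s => posSol k a b s * P.eval (affineCoord k a b s)) t
        + k * (posSol k a b t * P.eval (affineCoord k a b t))
      = sn k (b - a) ^ 2 / posSol k a b t ^ 3
        * P.derivative.derivative.eval (affineCoord k a b t) := by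
  have d1 : ∀ s ∈ Ioo a b, HasDerivAt (fun s => posSol k a b s * P.eval (affineCoord k a b s))
      (posSolDeriv k a b s * P.eval (affineCoord k a b s)
        + sn k (b - a) * P.derivative.eval (affineCoord k a b s) / posSol k a b s) s := by
    intro s hs
    have hφ := posSol_pos hab hk (Ioo_subset_Icc_self hs)
    convert! (hasDerivAt_posSol k a b s).mul
      ((P.hasDerivAt (affineCoord k a b s)).comp s (hasDerivAt_affineCoord hφ.ne')) using 1
    simp only [Function.comp]
    field_simp
  have hφ := posSol_pos hab hk (Ioo_subset_Icc_self ht)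
  have hev : deriv (fun s => posSol k a b s * P.eval (affineCoord k a b s)) =ᶠ[𝓝 t]
      fun s => posSolDeriv k a b s * P.eval (affineCoord k a b s)
        + sn k (b - a) * P.derivative.eval (affineCoord k a b s) / posSol k a b s := by
    filter_upwards [isOpen_Ioo.mem_nhds ht] with s hs using (d1 s hs).deriv
  have d2 := ((hasDerivAt_posSolDeriv k a b t).mul
      ((P.hasDerivAt (affineCoord k a b t)).comp t (hasDerivAt_affineCoord hφ.ne'))).add
      ((((P.derivative.hasDerivAt (affineCoord k a b t)).comp t
        (hasDerivAt_affineCoord hφ.ne')).const_mul (sn k (b - a))).div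
        (hasDerivAt_posSol k a b t) hφ.ne')
  rw [hev.deriv_eq]
  refine (congrArg (· + _) d2.deriv).trans ?_
  simp only [Function.comp]
  field_simp
  ring

/-- The approximations are `posSol` times Bernstein polynomials in the coordinate `affineCoord`. -/
lemma InterpConcave.exists_smooth_approximation {k a b : ℝ} (hab : a < b)
    (hk : k * (b - a) ^ 2 < Real.pi ^ 2) {f : ℝ → ℝ} (hf : InterpConcave k (Icc a b) f)
    (hcont : ContinuousOn f (Icc a b)) (h0 : ∀ t ∈ Icc a b, 0 ≤ f t)
    (hpos : ∀ t ∈ Ioo a b, 0 < f t) :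
    ∃ (F : ℕ → ℝ → ℝ) (M : ℝ), (∀ n, ContinuousOn (F n) (Icc a b)) ∧
      (∀ n, ∀ t ∈ Icc a b, 0 ≤ F n t ∧ F n t ≤ M) ∧ (∀ n, ∀ t ∈ Ioo a b, 0 < F n t) ∧
      (∀ n, ContDiffOn ℝ 2 (F n) (Ioo a b)) ∧
      (∀ n, ∀ t ∈ Ioo a b, deriv (deriv (F n)) t + k * F n t ≤ 0) ∧
      ∀ t ∈ Icc a b, Tendsto (fun n => F n t) atTop (𝓝 (f t)) := by
  have hφ : ∀ t ∈ Icc a b, 0 < posSol k a b t := fun t ht => posSol_pos hab hk ht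
  have hφc : Continuous (posSol k a b) :=
    continuous_iff_continuousAt.2 fun t => (hasDerivAt_posSol k a b t).continuousAt
  set e := affineCoordHomeo hab hk with he
  have hes : ∀ x, affineCoord k a b (e.symm x) = x := fun x => by
    rw [← coe_affineCoordHomeo hab hk, ← he, e.apply_symm_apply]
  have hmono : ∀ x y : unitInterval, x < y → (e.symm x : ℝ) < e.symm y := by
    intro x y hxy
    by_contra h
    have := (strictMonoOn_affineCoord hab hk).monotoneOn (e.symm y).2 (e.symm x).2 (not_lt.1 h)
    rw [hes, hes] at this
    exact absurd hxy (not_lt.2 (by exact_mod_cast this))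
  let G : C(unitInterval, ℝ) := ⟨fun x => f (e.symm x) / posSol k a b (e.symm x), by
    refine Continuous.div ?_ ?_ fun x => (hφ _ (e.symm x).2).ne'
    · exact (continuousOn_iff_continuous_domRestrict.1 hcont).comp e.symm.continuous
    · exact hφc.comp (continuous_subtype_val.comp e.symm.continuous)⟩
  have hG0 : ∀ x, 0 ≤ G x := fun x => div_nonneg (h0 _ (e.symm x).2) (hφ _ (e.symm x).2).le
  have hGe : ∀ t : Icc a b, G (e t) = f t / posSol k a b t := fun t => by
    change f (e.symm (e t)) / posSol k a b (e.symm (e t)) = _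
    rw [e.symm_apply_apply]
  let g : ℕ → ℕ → ℝ := fun n j => G (projIcc 0 1 zero_le_one ((j : ℝ) / n))
  let F : ℕ → ℝ → ℝ := fun n t =>
    posSol k a b t * (bernsteinSum (n + 2) (g (n + 2))).eval (affineCoord k a b t)
  have hFe : ∀ n (t : Icc a b), F n t = posSol k a b t * bernsteinApproximation (n + 2) G (e t) := by
    intro n t
    rw [← eval_bernsteinSum_eq_bernsteinApproximation, he, coe_affineCoordHomeo]
  have hlim : Tendsto (fun n => bernsteinApproximation (n + 2) G) atTop (𝓝 G) :=
    (bernsteinApproximation_uniform G).comp (tendsto_add_atTop_nat 2)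
  obtain ⟨A, hA⟩ := (isCompact_Icc (a := a) (b := b)).exists_bound_of_continuousOn hφc.continuousOn
  obtain ⟨B, hB⟩ := hlim.norm.bddAbove_range
  have hB : ∀ n, ‖bernsteinApproximation (n + 2) G‖ ≤ B := fun n => hB ⟨n, rfl⟩
  have hF0 : ∀ n, ∀ t ∈ Icc a b, 0 ≤ F n t := fun n t ht =>
    mul_nonneg (hφ t ht).le
      (eval_bernsteinSum_nonneg (n := n + 2) (g := g (n + 2)) (fun j _ => hG0 _)
        (mapsTo_affineCoord hab hk ht))
  -- The node `1 / (n + 2)` is interior, so the control value there is positive.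
  have hg1 : ∀ n, 0 < g (n + 2) 1 := by
    intro n
    set x : unitInterval := projIcc 0 1 zero_le_one (((1 : ℕ) : ℝ) / (n + 2 : ℕ)) with hx
    have hxm : ((1 : ℕ) : ℝ) / (n + 2 : ℕ) ∈ Ioo (0 : ℝ) 1 := by
      refine ⟨by positivity, ?_⟩
      rw [div_lt_one (by positivity)]; push_cast; linarith [(Nat.cast_nonneg n : (0 : ℝ) ≤ n)]
    have hxv : x = ⟨_, Ioo_subset_Icc_self hxm⟩ := projIcc_of_mem zero_le_one _
    have hlt0 : (0 : unitInterval) < x := by rw [hxv]; exact hxm.1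
    have hlt1 : x < (1 : unitInterval) := by rw [hxv]; exact hxm.2
    refine div_pos (hpos _ ⟨?_, ?_⟩) (hφ _ (e.symm x).2)
    · exact (e.symm 0).2.1.trans_lt (hmono _ _ hlt0)
    · exact (hmono _ _ hlt1).trans_le (e.symm 1).2.2
  have hgc : ∀ n, ∀ j ≤ n, g (n + 2) (j + 2) + g (n + 2) j ≤ 2 * g (n + 2) (j + 1) := by
    intro n j hj
    have hmem : ∀ i ≤ n + 2, ((i : ℕ) : ℝ) / (n + 2 : ℕ) ∈ Icc (0 : ℝ) 1 := by
      intro i hi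
      refine ⟨by positivity, ?_⟩
      rw [div_le_one (by positivity)]; exact_mod_cast hi
    have hp : ∀ i (hi : i ≤ n + 2), projIcc (0 : ℝ) 1 zero_le_one ((i : ℝ) / (n + 2 : ℕ))
        = ⟨_, hmem i hi⟩ := fun i hi => projIcc_of_mem zero_le_one _
    have hlt : ∀ i (hi : i + 1 ≤ n + 2), (⟨_, hmem i (by omega)⟩ : unitInterval)
        < ⟨_, hmem (i + 1) hi⟩ := by
      intro i hi
      rw [Subtype.mk_lt_mk]
      exact div_lt_div_of_pos_right (by push_cast; linarith) (by positivity)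
    simp only [g]
    rw [hp j (by omega), hp (j + 1) (by omega), hp (j + 2) (by omega), add_comm]
    refine hf.midpoint hab hk (e.symm _).2 (e.symm _).2 (hmono _ _ (hlt j (by omega)))
      (hmono _ _ (hlt (j + 1) (by omega))) ?_
    rw [hes, hes, hes]
    push_cast
    ring
  refine ⟨F, A * B, fun n => ?_, fun n t ht => ⟨hF0 n t ht, ?_⟩, fun n t ht => ?_, fun n => ?_,
    fun n t ht => ?_, fun t ht => ?_⟩
  · exact hφc.continuousOn.mul
      ((Polynomial.continuous _).comp_continuousOn (continuousOn_affineCoord hab hk))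
  · rw [hFe n ⟨t, ht⟩]
    have h1 : posSol k a b t ≤ A := (le_abs_self _).trans (hA t ht)
    have h2 := (le_abs_self _).trans
      ((ContinuousMap.norm_coe_le_norm (bernsteinApproximation (n + 2) G) (e ⟨t, ht⟩)).trans (hB n))
    have hB0 : 0 ≤ B := (norm_nonneg _).trans (hB 0)
    calc posSol k a b t * bernsteinApproximation (n + 2) G (e ⟨t, ht⟩)
        ≤ posSol k a b t * B := mul_le_mul_of_nonneg_left h2 (hφ t ht).le
      _ ≤ A * B := mul_le_mul_of_nonneg_right h1 hB0
  · exact mul_pos (hφ t (Ioo_subset_Icc_self ht))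
      (eval_bernsteinSum_pos (n := n + 2) (g := g (n + 2)) (fun j _ => hG0 _) (i := 1) (by omega)
        (hg1 n)
        (mapsTo_affineCoord_Ioo hab hk ht))
  · have c1 : ContDiff ℝ 2 fun t => sn k (t - a) :=
      (contDiff_sn k).comp (contDiff_id.sub contDiff_const)
    have c2 : ContDiff ℝ 2 (posSol k a b) :=
      ((contDiff_sn k).comp (contDiff_const.sub contDiff_id)).add c1
    have c3 : ContDiff ℝ 2 fun x => (bernsteinSum (n + 2) (g (n + 2))).eval x :=
      by simpa using (bernsteinSum (n + 2) (g (n + 2))).contDiff_aeval (𝕜 := ℝ) 2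
    refine c2.contDiffOn.mul (c3.comp_contDiffOn ?_)
    exact c1.contDiffOn.div c2.contDiffOn fun t ht => (hφ t (Ioo_subset_Icc_self ht)).ne'
  · refine (deriv_deriv_posSol_mul hab hk (bernsteinSum (n + 2) (g (n + 2))) ht).trans_le ?_
    refine mul_nonpos_of_nonneg_of_nonpos ?_ (eval_derivative_derivative_bernsteinSum_nonpos
      (n := n) (g := g (n + 2)) (hgc n) (mapsTo_affineCoord hab hk (Ioo_subset_Icc_self ht)))
    have := hφ t (Ioo_subset_Icc_self ht)
    positivity
  · have h1 : Tendsto (fun n => bernsteinApproximation (n + 2) G (e ⟨t, ht⟩)) atTop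
        (𝓝 (G (e ⟨t, ht⟩))) := ((continuous_eval_const (e ⟨t, ht⟩)).tendsto G).comp hlim
    have h2 := h1.const_mul (posSol k a b t)
    rw [hGe, mul_div_cancel₀ _ (hφ t ht).ne'] at h2
    exact h2.congr fun n => (hFe n ⟨t, ht⟩).symm

/-! ### Consequences of interpolation concavity -/

lemma InterpConcave.mono {k : ℝ} {J J' : Set ℝ} {f : ℝ → ℝ} (hf : InterpConcave k J f)
    (h : J' ⊆ J) : InterpConcave k J' f := fun x hx z hz => hf x (h hx) z (h hz)

lemma InterpConcave.congr {k : ℝ} {J : Set ℝ} [hJ : OrdConnected J] {f g : ℝ → ℝ}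
    (hf : InterpConcave k J f) (h : EqOn f g J) : InterpConcave k J g := by
  intro x hx z hz hxz hk y hy
  rw [← h hx, ← h hz, ← h (hJ.out hx hz hy)]
  exact hf x hx z hz hxz hk y hy

lemma InterpConcave.pos_between {k : ℝ} {J : Set ℝ} {f : ℝ → ℝ} (hf : InterpConcave k J f)
    (h0 : ∀ t ∈ J, 0 ≤ f t) {x y z : ℝ} (hx : x ∈ J) (hz : z ∈ J) (hxy : x < y) (hyz : y < z)
    (hk : k * (z - x) ^ 2 < Real.pi ^ 2) (hpos : 0 < f x ∨ 0 < f z) : 0 < f y := by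
  have h := hf x hx z hz (hxy.trans hyz) hk y ⟨hxy.le, hyz.le⟩
  have hpi : (0 : ℝ) < Real.pi ^ 2 := by positivity
  have s1 : 0 < sn k (z - y) :=
    sn_pos (by linarith) (mul_sq_lt_of_le hpi (by linarith) (by linarith) hk)
  have s2 : 0 < sn k (y - x) :=
    sn_pos (by linarith) (mul_sq_lt_of_le hpi (by linarith) (by linarith) hk)
  have s3 : 0 < sn k (z - x) := sn_pos (by linarith) hk
  have fx := h0 x hx
  have fz := h0 z hz
  refine pos_of_mul_pos_right (lt_of_lt_of_le ?_ h) s3.le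
  rcases hpos with h' | h' <;> positivity

/-- A nonnegative interpolation concave function that does not vanish identically has no zero in
the open interval: positivity propagates both ways over short distances. -/
lemma InterpConcave.pos_of_pos {k a b : ℝ} {f : ℝ → ℝ} (hf : InterpConcave k (Ioo a b) f)
    (h0 : ∀ t ∈ Ioo a b, 0 ≤ f t) {x y : ℝ} (hx : x ∈ Ioo a b) (hy : y ∈ Ioo a b)
    (hfx : 0 < f x) : 0 < f y := by
  refine isPreconnected_Ioo.induction₂' (fun x y => 0 < f x → 0 < f y) ?_
    (fun _ _ _ _ _ _ h1 h2 h => h2 (h1 h)) hx hy hfx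
  intro x hx
  have hnear : ∀ᶠ δ : ℝ in 𝓝[>] 0, x - δ ∈ Ioo a b ∧ x + δ ∈ Ioo a b ∧
      k * (2 * δ) ^ 2 < Real.pi ^ 2 := by
    have t1 : Tendsto (fun δ : ℝ => x - δ) (𝓝[>] 0) (𝓝 x) := by
      have : Continuous fun δ : ℝ => x - δ := by fun_prop
      simpa using (this.tendsto 0).mono_left nhdsWithin_le_nhds
    have t2 : Tendsto (fun δ : ℝ => x + δ) (𝓝[>] 0) (𝓝 x) := by
      have : Continuous fun δ : ℝ => x + δ := by fun_prop
      simpa using (this.tendsto 0).mono_left nhdsWithin_le_nhds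
    have t3 : Tendsto (fun δ : ℝ => k * (2 * δ) ^ 2) (𝓝[>] 0) (𝓝 0) := by
      have : Continuous fun δ : ℝ => k * (2 * δ) ^ 2 := by fun_prop
      simpa using (this.tendsto 0).mono_left nhdsWithin_le_nhds
    have hmem := isOpen_Ioo.mem_nhds hx
    filter_upwards [t1 hmem, t2 hmem, t3.eventually_lt_const (by positivity : 0 < Real.pi ^ 2)]
      with δ h1 h2 h3 using ⟨h1, h2, h3⟩
  obtain ⟨δ, ⟨h1, h2, h3⟩, hδ⟩ := (hnear.and self_mem_nhdsWithin).exists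
  have hδ : 0 < δ := hδ
  have hpi : (0 : ℝ) < Real.pi ^ 2 := by positivity
  have hshort : ∀ d, 0 ≤ d → d ≤ 2 * δ → k * d ^ 2 < Real.pi ^ 2 := fun d hd hd' =>
    mul_sq_lt_of_le hpi hd hd' h3
  filter_upwards [mem_nhdsWithin_of_mem_nhds (isOpen_Ioo.mem_nhds
    (show x ∈ Ioo (x - δ) (x + δ) from ⟨by linarith, by linarith⟩)), self_mem_nhdsWithin]
    with y hyδ hy
  rcases lt_trichotomy x y with hxy | rfl | hxy
  · exact ⟨fun h => hf.pos_between h0 hx h2 hxy hyδ.2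
        (hshort _ (by linarith) (by linarith)) (.inl h),
      fun h => hf.pos_between h0 h1 hy (by linarith) hxy
        (hshort _ (by linarith [hyδ.2]) (by linarith [hyδ.2])) (.inr h)⟩
  · exact ⟨id, id⟩
  · exact ⟨fun h => hf.pos_between h0 h1 hx hyδ.1 hxy
        (hshort _ (by linarith) (by linarith)) (.inr h),
      fun h => hf.pos_between h0 hy h2 hxy (by linarith)
        (hshort _ (by linarith [hyδ.1]) (by linarith [hyδ.1])) (.inl h)⟩

/-- Rigidity on an interval of the maximal length `π / √k`: sending one of the two interpolation
points to an end of the interval shows that `f / sn k (· - a)` is both increasing and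
decreasing. -/
lemma InterpConcave.eq_const_mul_sn {k a b : ℝ} (hab : a < b)
    (hk : k * (b - a) ^ 2 = Real.pi ^ 2) {f : ℝ → ℝ} (hf : InterpConcave k (Ioo a b) f)
    (h0 : ∀ t ∈ Ioo a b, 0 ≤ f t) : ∃ c, ∀ t ∈ Ioo a b, f t = c * sn k (t - a) := by
  have hk0 : 0 < k := by
    by_contra h
    nlinarith [sq_nonneg (b - a), pow_pos Real.pi_pos 2]
  have hshort : ∀ d, 0 ≤ d → d < b - a → k * d ^ 2 < Real.pi ^ 2 := by
    intro d hd hd'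
    rw [← hk]
    exact mul_lt_mul_of_pos_left (pow_lt_pow_left₀ hd' hd two_ne_zero) hk0
  have hcont := continuous_sn k
  have hrefl : ∀ t, sn k (b - t) = sn k (t - a) := fun t => by
    rw [← sn_sub_of_mul_sq_eq (sub_pos.2 hab) hk (t - a)]; congr 1; ring
  have key : ∀ x ∈ Ioo a b, ∀ y ∈ Ioo a b, x < y → sn k (y - a) * f x = sn k (x - a) * f y := by
    intro x hx y hy hxy
    apply le_antisymm
    · have t1 : Tendsto (fun z => sn k (z - y) * f x) (𝓝[<] b) (𝓝 (sn k (b - y) * f x)) :=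
        ((by fun_prop : Continuous fun z => sn k (z - y) * f x).tendsto b).mono_left
          nhdsWithin_le_nhds
      have t2 : Tendsto (fun z => sn k (z - x) * f y) (𝓝[<] b) (𝓝 (sn k (b - x) * f y)) :=
        ((by fun_prop : Continuous fun z => sn k (z - x) * f y).tendsto b).mono_left
          nhdsWithin_le_nhds
      rw [hrefl] at t1 t2
      refine le_of_tendsto_of_tendsto t1 t2 ?_
      filter_upwards [Ioo_mem_nhdsLT hy.2] with z hz
      have hz' : z ∈ Ioo a b := ⟨hy.1.trans hz.1, hz.2⟩
      have h := hf x hx z hz' (hxy.trans hz.1)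
        (hshort _ (by linarith [hz.1]) (by linarith [hz.2, hx.1])) y ⟨hxy.le, hz.1.le⟩
      have hs := sn_pos (sub_pos.2 hxy)
        (hshort (y - x) (by linarith) (by linarith [hy.2, hx.1]))
      nlinarith [h0 z hz']
    · have t1 : Tendsto (fun z => sn k (x - z) * f y) (𝓝[>] a) (𝓝 (sn k (x - a) * f y)) :=
        ((by fun_prop : Continuous fun z => sn k (x - z) * f y).tendsto a).mono_left
          nhdsWithin_le_nhds
      have t2 : Tendsto (fun z => sn k (y - z) * f x) (𝓝[>] a) (𝓝 (sn k (y - a) * f x)) :=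
        ((by fun_prop : Continuous fun z => sn k (y - z) * f x).tendsto a).mono_left
          nhdsWithin_le_nhds
      refine le_of_tendsto_of_tendsto t1 t2 ?_
      filter_upwards [Ioo_mem_nhdsGT hx.1] with z hz
      have hz' : z ∈ Ioo a b := ⟨hz.1, hz.2.trans hx.2⟩
      have h := hf z hz' y hy (hz.2.trans hxy)
        (hshort _ (by linarith [hz.2]) (by linarith [hz.1, hy.2])) x ⟨hz.2.le, hxy.le⟩
      have hs := sn_pos (sub_pos.2 hxy)
        (hshort (y - x) (by linarith) (by linarith [hy.2, hx.1]))
      nlinarith [h0 z hz']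
  have hm : (a + b) / 2 ∈ Ioo a b := ⟨by linarith, by linarith⟩
  have hsm : 0 < sn k ((a + b) / 2 - a) :=
    sn_pos (by linarith) (hshort _ (by linarith) (by linarith))
  generalize (a + b) / 2 = m at hm hsm
  refine ⟨f m / sn k (m - a), fun t ht => ?_⟩
  rw [div_mul_eq_mul_div, eq_div_iff hsm.ne']
  rcases lt_trichotomy t m with h | rfl | h
  · linarith [key t ht m hm h]
  · rfl
  · linarith [key m hm t ht h]

/-- A nontrivial interpolation concave function lives on an interval of length at most
`π / √k`. -/
lemma InterpConcave.length_le {k a b : ℝ} {f : ℝ → ℝ} (hf : InterpConcave k (Ioo a b) f)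
    (hcont : ContinuousOn f (Ioo a b)) (hpos : ∀ t ∈ Ioo a b, 0 < f t) (hab : a < b) :
    k * (b - a) ^ 2 ≤ Real.pi ^ 2 := by
  by_contra! h
  have hk0 : 0 < k := by
    by_contra h'
    nlinarith [sq_nonneg (b - a), pow_pos Real.pi_pos 2]
  have hs : 0 < √k := Real.sqrt_pos.2 hk0
  set L := Real.pi / √k with hL
  have hL0 : 0 < L := div_pos Real.pi_pos hs
  have hkL : k * L ^ 2 = Real.pi ^ 2 := by
    rw [hL, div_pow, Real.sq_sqrt hk0.le]; field_simp
  have hlt : L < b - a := by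
    refine lt_of_pow_lt_pow_left₀ 2 (by linarith) ?_
    rw [← hkL] at h
    exact lt_of_mul_lt_mul_left h hk0.le
  -- On a subinterval of length `L` with interior end `a'`, rigidity forces `f a' = 0`.
  set a' := a + (b - a - L) / 2 with ha'
  have hsub : Ioo a' (a' + L) ⊆ Ioo a b :=
    Ioo_subset_Ioo (by rw [ha']; linarith) (by rw [ha']; linarith)
  obtain ⟨c, hc⟩ := (hf.mono hsub).eq_const_mul_sn (by linarith)
    (by rw [add_sub_cancel_left]; exact hkL) (fun t ht => (hpos t (hsub ht)).le)
  have hmem : a' ∈ Ioo a b := ⟨by rw [ha']; linarith, by rw [ha']; linarith⟩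
  have t1 : Tendsto f (𝓝[>] a') (𝓝 (f a')) :=
    (hcont.continuousAt (isOpen_Ioo.mem_nhds hmem)).tendsto.mono_left nhdsWithin_le_nhds
  have t2 : Tendsto (fun t => c * sn k (t - a')) (𝓝[>] a') (𝓝 0) := by
    have hcs := continuous_sn k
    have : Continuous fun t => c * sn k (t - a') := by fun_prop
    simpa [sn_zero] using (this.tendsto a').mono_left nhdsWithin_le_nhds
  have hev : f =ᶠ[𝓝[>] a'] fun t => c * sn k (t - a') := by
    filter_upwards [Ioo_mem_nhdsGT (show a' < a' + L by linarith)] with t ht using hc t ht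
  have := tendsto_nhds_unique t1 (t2.congr' hev.symm)
  exact (hpos a' hmem).ne' this

/-- Interpolation concavity passes to the closed interval: shrink towards the midpoint. -/
lemma InterpConcave.Icc_of_Ioo {k a b : ℝ} (hab : a < b) {f : ℝ → ℝ}
    (hf : InterpConcave k (Ioo a b) f) (hcont : ContinuousOn f (Icc a b)) :
    InterpConcave k (Icc a b) f := by
  intro x hx z hz hxz hk y hy
  have hy' : y ∈ Icc a b := ⟨hx.1.trans hy.1, hy.2.trans hz.2⟩
  set c : ℝ → ℝ → ℝ := fun t ε => (1 - ε) * t + ε * ((a + b) / 2) with hc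
  have hcIoo : ∀ t ∈ Icc a b, ∀ ε ∈ Ioo (0 : ℝ) 1, c t ε ∈ Ioo a b := by
    intro t ht ε hε
    have h1 : 0 < 1 - ε := by linarith [hε.2]
    constructor
    · simp only [hc]; nlinarith [ht.1, hε.1]
    · simp only [hc]; nlinarith [ht.2, hε.1]
  have hcIcc : ∀ t ∈ Icc a b, MapsTo (c t) (Icc 0 1) (Icc a b) := by
    intro t ht ε hε
    have h1 : 0 ≤ 1 - ε := by linarith [hε.2]
    constructor
    · simp only [hc]; nlinarith [ht.1, hε.1]
    · simp only [hc]; nlinarith [ht.2, hε.1]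
  have hcc : ∀ t, Continuous (c t) := fun t => by simp only [hc]; fun_prop
  have hsc := continuous_sn k
  have hfc : ∀ t ∈ Icc a b, ContinuousOn (fun ε => f (c t ε)) (closure (Ioo (0 : ℝ) 1)) := by
    intro t ht
    rw [closure_Ioo zero_ne_one]
    exact hcont.comp (hcc t).continuousOn (hcIcc t ht)
  have hsn : ∀ s t, ContinuousOn (fun ε => sn k (c s ε - c t ε)) (closure (Ioo (0 : ℝ) 1)) :=
    fun s t => (hsc.comp ((hcc s).sub (hcc t))).continuousOn
  have h := le_on_closure (s := Ioo (0 : ℝ) 1)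
    (f := fun ε => sn k (c z ε - c y ε) * f (c x ε) + sn k (c y ε - c x ε) * f (c z ε))
    (g := fun ε => sn k (c z ε - c x ε) * f (c y ε)) ?_
    (((hsn z y).mul (hfc x hx)).add ((hsn y x).mul (hfc z hz))) ((hsn z x).mul (hfc y hy'))
    (show (0 : ℝ) ∈ closure (Ioo (0 : ℝ) 1) by
      rw [closure_Ioo zero_ne_one]; exact left_mem_Icc.2 zero_le_one)
  · simpa [hc] using h
  · intro ε hε
    have h1 : 0 < 1 - ε := by linarith [hε.2]
    have e : ∀ s t, c s ε - c t ε = (1 - ε) * (s - t) := fun s t => by simp only [hc]; ring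
    have mono : ∀ s t, s ≤ t → c s ε ≤ c t ε := fun s t hst => by
      have := e t s; nlinarith
    refine hf _ (hcIoo x hx ε hε) _ (hcIoo z hz ε hε) ?_ ?_ _ ⟨mono _ _ hy.1, mono _ _ hy.2⟩
    · have := e z x; nlinarith
    · rw [e]
      exact mul_sq_lt_of_le (by positivity) (mul_nonneg h1.le (by linarith))
        (by nlinarith [hε.1]) hk

/-! ### Comparison with weak concavity -/

lemma sigma_of_lt {K n s θ : ℝ} (hn : 0 < n) (hθ : 0 < θ) (h : K / n * θ ^ 2 < Real.pi ^ 2) :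
    sigma K n s θ = ENNReal.ofReal (sn (K / n) (s * θ) / sn (K / n) θ) := by
  have h1 : ¬ n * Real.pi ^ 2 ≤ K * θ ^ 2 := by
    rw [not_le]
    have e : K * θ ^ 2 = n * (K / n * θ ^ 2) := by field_simp
    rw [e]
    exact mul_lt_mul_of_pos_left h hn
  have hθ2 : 0 < θ ^ 2 := by positivity
  unfold sigma sn
  rw [if_neg h1]
  rcases lt_trichotomy K 0 with hK | rfl | hK
  · have hKn : K / n < 0 := div_neg_of_neg_of_pos hK hn
    have hs : √(-(K / n)) ≠ 0 := (Real.sqrt_pos.2 (by linarith)).ne'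
    rw [if_neg (by nlinarith), if_neg (by
      rintro (h | h)
      · nlinarith
      · exact hn.ne' h), if_neg hKn.le.not_gt, if_neg hKn.ne, if_neg hKn.le.not_gt, if_neg hKn.ne,
      div_div_div_cancel_right₀ hs, neg_div]
    congr 3 <;> ring
  · simp [hθ.ne']
  · have hKn : 0 < K / n := div_pos hK hn
    have hs : √(K / n) ≠ 0 := (Real.sqrt_pos.2 hKn).ne'
    rw [if_pos (by positivity), if_pos hKn, if_pos hKn, div_div_div_cancel_right₀ hs]
    congr 3 <;> ring

lemma WeakConcave.interpConcave {K N a b : ℝ} (hN : 1 < N) {h : ℝ → ℝ}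
    (hw : WeakConcave K N a b h) (h0 : ∀ t ∈ Icc a b, 0 ≤ h t) :
    InterpConcave (K / (N - 1)) (Icc a b) fun t => h t ^ (1 / (N - 1)) := by
  intro x hx z hz hxz hk y hy
  have hn : 0 < N - 1 := by linarith
  have hd : 0 < z - x := by linarith
  have hpi : (0 : ℝ) < Real.pi ^ 2 := by positivity
  have hS := sn_pos hd hk
  have e1 : (1 - (y - x) / (z - x)) * x + (y - x) / (z - x) * z = y := by field_simp; ring
  have e2 : (1 - (y - x) / (z - x)) * (z - x) = z - y := by field_simp; ring
  have e3 : (y - x) / (z - x) * (z - x) = y - x := by field_simp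
  have h1 := hw x hx z hz hxz ((y - x) / (z - x))
    ⟨div_nonneg (by linarith [hy.1]) hd.le, (div_le_one hd).2 (by linarith [hy.2])⟩
  have s1 : 0 ≤ sn (K / (N - 1)) (z - y) :=
    sn_nonneg (by linarith [hy.2]) (mul_sq_lt_of_le hpi (by linarith [hy.2]) (by linarith [hy.1]) hk)
  have s2 : 0 ≤ sn (K / (N - 1)) (y - x) :=
    sn_nonneg (by linarith [hy.1]) (mul_sq_lt_of_le hpi (by linarith [hy.1]) (by linarith [hy.2]) hk)
  have p : ∀ t ∈ Icc a b, 0 ≤ h t ^ (1 / (N - 1)) := fun t ht => Real.rpow_nonneg (h0 t ht) _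
  have px := p x hx
  have pz := p z hz
  have py := p y ⟨hx.1.trans hy.1, hy.2.trans hz.2⟩
  rw [sigma_of_lt hn hd hk, sigma_of_lt hn hd hk, e1, e2, e3, ← ENNReal.ofReal_mul (by positivity),
    ← ENNReal.ofReal_mul (by positivity), ← ENNReal.ofReal_add (by positivity) (by positivity),
    ENNReal.ofReal_le_ofReal_iff py] at h1
  have h2 := mul_le_mul_of_nonneg_left h1 hS.le
  refine le_trans (le_of_eq ?_) h2
  field_simp

/-- The length bound leaves the infinite values of `sigma` only for the pair of end points, where
the convention `∞ * 0 = 0` applies. -/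
lemma InterpConcave.weakConcave {K N a b : ℝ} (hN : 1 < N) (hab : a < b) {h : ℝ → ℝ}
    (hf : InterpConcave (K / (N - 1)) (Icc a b) fun t => h t ^ (1 / (N - 1)))
    (h0 : ∀ t ∈ Icc a b, 0 ≤ h t) (hlen : K / (N - 1) * (b - a) ^ 2 ≤ Real.pi ^ 2)
    (hend : K / (N - 1) * (b - a) ^ 2 = Real.pi ^ 2 →
      h a ^ (1 / (N - 1)) = 0 ∧ h b ^ (1 / (N - 1)) = 0) : WeakConcave K N a b h := by
  intro x hx z hz hxz s hs
  have hn : 0 < N - 1 := by linarith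
  have hd : 0 < z - x := by linarith
  rcases lt_or_ge (K / (N - 1) * (z - x) ^ 2) (Real.pi ^ 2) with hk | hk
  · have hpi : (0 : ℝ) < Real.pi ^ 2 := by positivity
    have hS := sn_pos hd hk
    have hs1 : 0 ≤ 1 - s := by linarith [hs.2]
    have s1 : 0 ≤ sn (K / (N - 1)) ((1 - s) * (z - x)) :=
      sn_nonneg (by positivity) (mul_sq_lt_of_le hpi (by positivity) (by nlinarith [hs.1]) hk)
    have s2 : 0 ≤ sn (K / (N - 1)) (s * (z - x)) :=
      sn_nonneg (mul_nonneg hs.1 hd.le)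
        (mul_sq_lt_of_le hpi (mul_nonneg hs.1 hd.le) (by nlinarith [hs.2]) hk)
    have hy : (1 - s) * x + s * z ∈ Icc x z := ⟨by nlinarith [hs.1], by nlinarith [hs.2]⟩
    have p : ∀ t ∈ Icc a b, 0 ≤ h t ^ (1 / (N - 1)) := fun t ht => Real.rpow_nonneg (h0 t ht) _
    have px := p x hx
    have pz := p z hz
    have py := p _ ⟨hx.1.trans hy.1, hy.2.trans hz.2⟩
    have h1 := hf x hx z hz hxz hk _ hy
    have e1 : z - ((1 - s) * x + s * z) = (1 - s) * (z - x) := by ring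
    have e2 : (1 - s) * x + s * z - x = s * (z - x) := by ring
    rw [e1, e2] at h1
    rw [sigma_of_lt hn hd hk, sigma_of_lt hn hd hk, ← ENNReal.ofReal_mul (by positivity),
      ← ENNReal.ofReal_mul (by positivity), ← ENNReal.ofReal_add (by positivity) (by positivity),
      ENNReal.ofReal_le_ofReal_iff py]
    refine le_of_mul_le_mul_left (le_trans (le_of_eq ?_) h1) hS
    field_simp
  · have hk0 : 0 < K / (N - 1) := by
      by_contra h'
      nlinarith [sq_nonneg (z - x), pow_pos Real.pi_pos 2]
    have hle : (b - a) ^ 2 ≤ (z - x) ^ 2 := le_of_mul_le_mul_left (hlen.trans hk) hk0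
    have hle' : b - a ≤ z - x := le_of_sq_le_sq hle hd.le
    obtain rfl : x = a := by linarith [hx.1, hz.2]
    obtain rfl : z = b := by linarith [hz.2]
    obtain ⟨ha, hb⟩ := hend (le_antisymm hlen hk)
    rw [ha, hb]
    simp

/-! ### Boundary values and the inclusion of the smooth class -/

/-- Subtracting from `f` the multiple of `sn k (· - a)` that makes the Wronskian vanish at the
midpoint leaves a function whose ratio to `posSol` is monotone on each half of the interval. -/
lemma exists_tendsto_endpoints_of_lt {k a b : ℝ} (hab : a < b)
    (hk : k * (b - a) ^ 2 < Real.pi ^ 2) {f f' f'' : ℝ → ℝ}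
    (hf : ∀ t ∈ Ioo a b, HasDerivAt f (f' t) t) (hf' : ∀ t ∈ Ioo a b, HasDerivAt f' (f'' t) t)
    (hle : ∀ t ∈ Ioo a b, f'' t + k * f t ≤ 0) (h0 : ∀ t ∈ Ioo a b, 0 ≤ f t) :
    (∃ l, Tendsto f (𝓝[>] a) (𝓝 l)) ∧ ∃ l, Tendsto f (𝓝[<] b) (𝓝 l) := by
  set m := (a + b) / 2 with hm
  have ham : a < m := by rw [hm]; linarith
  have hmb : m < b := by rw [hm]; linarith
  have hmI : m ∈ Ioo a b := ⟨ham, hmb⟩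
  have hφ : ∀ t ∈ Icc a b, 0 < posSol k a b t := fun t ht => posSol_pos hab hk ht
  have hφ' : ∀ t ∈ Ioo a b, 0 < posSol k a b t := fun t ht => hφ t (Ioo_subset_Icc_self ht)
  have hW : 0 < sn k (b - a) := sn_pos (sub_pos.2 hab) hk
  set c := (f' m * posSol k a b m - f m * posSolDeriv k a b m) / sn k (b - a) with hc
  set w : ℝ → ℝ := fun t => f t - c * sn k (t - a) with hw
  set w' : ℝ → ℝ := fun t => f' t - c * cs k (t - a) with hw'
  have d1 : ∀ t ∈ Ioo a b, HasDerivAt w (w' t) t := fun t ht =>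
    (hf t ht).sub ((hasDerivAt_sn_sub k a t).const_mul c)
  have d2 : ∀ t ∈ Ioo a b, HasDerivAt w' (f'' t - c * (-k * sn k (t - a))) t := fun t ht =>
    (hf' t ht).sub ((hasDerivAt_cs_sub k a t).const_mul c)
  have anti := wronskian_antitoneOn (convex_Ioo a b) d1 d2
    (fun t ht => by have := hle t ht; simp only [hw]; linarith) (hasDerivAt_posSol k a b)
    (hasDerivAt_posSolDeriv k a b) (fun t ht => (hφ' t ht).le)
  have hWm : w' m * posSol k a b m - w m * posSolDeriv k a b m = 0 := by
    have h1 := posSol_wronskian k a b m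
    have h2 : c * sn k (b - a) = f' m * posSol k a b m - f m * posSolDeriv k a b m := by
      rw [hc]; field_simp
    simp only [hw, hw']
    linear_combination -c * h1 - h2
  have hs1 : Ioo a m ⊆ Ioo a b := Ioo_subset_Ioo_right hmb.le
  have hs2 : Ioo m b ⊆ Ioo a b := Ioo_subset_Ioo_left ham.le
  have m1 := ratio_monotoneOn (convex_Ioo a m) (fun t ht => d1 t (hs1 ht))
    (hasDerivAt_posSol k a b) (fun t ht => hφ' t (hs1 ht))
    (fun t ht => hWm.symm.le.trans (anti (hs1 ht) hmI ht.2.le))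
  have m2 := ratio_antitoneOn (convex_Ioo m b) (fun t ht => d1 t (hs2 ht))
    (hasDerivAt_posSol k a b) (fun t ht => hφ' t (hs2 ht))
    (fun t ht => (anti hmI (hs2 ht) ht.1.le).trans hWm.le)
  have hbd : ∀ t ∈ Ioo a b, -|c| ≤ w t / posSol k a b t := by
    intro t ht
    have h1 := mapsTo_affineCoord hab hk (Ioo_subset_Icc_self ht)
    have h2 : w t / posSol k a b t = f t / posSol k a b t - c * affineCoord k a b t := by
      simp only [hw, affineCoord]; ring
    have h3 : c * affineCoord k a b t ≤ |c| := by
      calc c * affineCoord k a b t ≤ |c| * affineCoord k a b t :=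
            mul_le_mul_of_nonneg_right (le_abs_self c) h1.1
        _ ≤ |c| * 1 := mul_le_mul_of_nonneg_left h1.2 (abs_nonneg c)
        _ = |c| := mul_one _
    have h4 := div_nonneg (h0 t ht) (hφ' t ht).le
    linarith
  have l1 := m1.tendsto_nhdsWithin_Ioo_right (nonempty_Ioo.2 ham)
    ⟨-|c|, by rintro _ ⟨t, ht, rfl⟩; exact hbd t (hs1 ht)⟩
  have l2 := m2.tendsto_nhdsWithin_Ioo_left (nonempty_Ioo.2 hmb)
    ⟨-|c|, by rintro _ ⟨t, ht, rfl⟩; exact hbd t (hs2 ht)⟩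
  have hcsn := continuous_sn k
  have hφc : Continuous (posSol k a b) :=
    continuous_iff_continuousAt.2 fun t => (hasDerivAt_posSol k a b t).continuousAt
  have hsc : Continuous fun t => c * sn k (t - a) := by fun_prop
  have hfe : ∀ t ∈ Ioo a b, posSol k a b t * (w t / posSol k a b t) + c * sn k (t - a) = f t := by
    intro t ht
    rw [mul_div_cancel₀ _ (hφ' t ht).ne']
    simp [hw]
  constructor
  · refine ⟨_, ((((hφc.tendsto a).mono_left nhdsWithin_le_nhds).mul l1).add
      ((hsc.tendsto a).mono_left nhdsWithin_le_nhds)).congr' ?_⟩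
    filter_upwards [Ioo_mem_nhdsGT hab] with t ht using hfe t ht
  · refine ⟨_, ((((hφc.tendsto b).mono_left nhdsWithin_le_nhds).mul l2).add
      ((hsc.tendsto b).mono_left nhdsWithin_le_nhds)).congr' ?_⟩
    filter_upwards [Ioo_mem_nhdsLT hab] with t ht using hfe t ht

/-- On an interval of the maximal length the boundary values are zero, since `f` is a multiple of
`sn k (· - a)`. -/
lemma tendsto_endpoints_of_eq {k a b : ℝ} (hab : a < b)
    (hk : k * (b - a) ^ 2 = Real.pi ^ 2) {f : ℝ → ℝ} (hf : InterpConcave k (Ioo a b) f)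
    (h0 : ∀ t ∈ Ioo a b, 0 ≤ f t) :
    Tendsto f (𝓝[>] a) (𝓝 0) ∧ Tendsto f (𝓝[<] b) (𝓝 0) := by
  obtain ⟨c, hc⟩ := hf.eq_const_mul_sn hab hk h0
  have hcsn := continuous_sn k
  have hsc : Continuous fun t => c * sn k (t - a) := by fun_prop
  have hb : sn k (b - a) = 0 := by
    have := sn_sub_of_mul_sq_eq (sub_pos.2 hab) hk 0
    rwa [sub_zero, sn_zero] at this
  constructor
  · have t := (hsc.tendsto a).mono_left (nhdsWithin_le_nhds (s := Ioi a))
    rw [sub_self, sn_zero, mul_zero] at t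
    refine t.congr' ?_
    filter_upwards [Ioo_mem_nhdsGT hab] with t ht using (hc t ht).symm
  · have t := (hsc.tendsto b).mono_left (nhdsWithin_le_nhds (s := Iio b))
    rw [hb, mul_zero] at t
    refine t.congr' ?_
    filter_upwards [Ioo_mem_nhdsLT hab] with t ht using (hc t ht).symm

lemma densityMeasure_congr {a b : ℝ} {h h' : ℝ → ℝ} (he : EqOn h h' (Ioo a b)) :
    densityMeasure a b h = densityMeasure a b h' := by
  unfold densityMeasure
  rw [← restrict_Ioo_eq_restrict_Icc]
  refine withDensity_congr_ae ?_
  filter_upwards [ae_restrict_mem measurableSet_Ioo] with t ht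
  rw [he ht]

lemma exists_pos_of_isProbabilityMeasure {a b : ℝ} {h : ℝ → ℝ}
    (hμ : IsProbabilityMeasure (densityMeasure a b h)) : ∃ x ∈ Ioo a b, 0 < h x := by
  by_contra! hneg
  have h1 : densityMeasure a b h = 0 := by
    have e : densityMeasure a b h = densityMeasure a b (fun t => min (h t) 0) :=
      densityMeasure_congr fun t ht => (min_eq_left (hneg t ht)).symm
    rw [e]
    have : (fun t => ENNReal.ofReal (min (h t) 0)) = 0 := by
      funext t; simp
    unfold densityMeasure
    rw [this, withDensity_zero]
  have h2 := hμ.measure_univ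
  rw [h1] at h2
  simp at h2

lemma rpow_rpow_inv_of_nonneg {N x : ℝ} (hN : 1 < N) (hx : 0 ≤ x) :
    (x ^ (1 / (N - 1))) ^ (N - 1) = x := by
  rw [← Real.rpow_mul hx, one_div_mul_cancel (by linarith), Real.rpow_one]

lemma continuousOn_rpow_one_div {N : ℝ} (hN : 1 < N) {h : ℝ → ℝ} {s : Set ℝ}
    (hc : ContinuousOn h s) : ContinuousOn (fun t => h t ^ (1 / (N - 1))) s :=
  hc.rpow_const fun _ _ => .inr (one_div_nonneg.2 (by linarith))

/-- A smooth density extends continuously to the closed interval, and the extension is weakly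
concave. -/
lemma smoothOn_subset_syntheticOn {K N a b : ℝ} (hN : 1 ≤ N) (hab : a < b) :
    smoothOn K N a b ⊆ syntheticOn K N a b := by
  rintro μ ⟨hμ, h, rfl, h0, hsm, hone⟩
  rcases hN.eq_or_lt with rfl | hN
  · obtain ⟨c, hc⟩ := hone rfl
    have hm : (a + b) / 2 ∈ Ioo a b := ⟨by linarith, by linarith⟩
    refine ⟨hμ, fun _ => c, densityMeasure_congr hc, fun _ _ => ?_, fun h => absurd h (lt_irrefl _),
      fun _ => ⟨c, fun _ _ => rfl⟩⟩
    rw [← hc _ hm]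
    exact h0 _ hm
  obtain ⟨hsmooth, hd, hdd, hle⟩ := hsm hN
  have hn : 0 < N - 1 := by linarith
  set k := K / (N - 1) with hk
  set f : ℝ → ℝ := fun t => h t ^ (1 / (N - 1)) with hf
  have d1 : ∀ t ∈ Ioo a b, HasDerivAt f (deriv f t) t := fun t ht =>
    (hd.differentiableAt (isOpen_Ioo.mem_nhds ht)).hasDerivAt
  have d2 : ∀ t ∈ Ioo a b, HasDerivAt (deriv f) (deriv (deriv f) t) t := fun t ht =>
    (hdd.differentiableAt (isOpen_Ioo.mem_nhds ht)).hasDerivAt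
  have f0 : ∀ t ∈ Ioo a b, 0 ≤ f t := fun t ht => Real.rpow_nonneg (h0 t ht) _
  have hic : InterpConcave k (Ioo a b) f := interpConcave_of_deriv ordConnected_Ioo d1 d2 hle
  obtain ⟨x, hx, hxpos⟩ := exists_pos_of_isProbabilityMeasure hμ
  have fpos : ∀ t ∈ Ioo a b, 0 < f t := fun t ht =>
    hic.pos_of_pos f0 hx ht (Real.rpow_pos_of_pos hxpos _)
  have hlen : k * (b - a) ^ 2 ≤ Real.pi ^ 2 := hic.length_le hd.continuousOn fpos hab
  have hpow : ∀ t ∈ Ioo a b, f t ^ (N - 1) = h t := fun t ht => rpow_rpow_inv_of_nonneg hN (h0 t ht)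
  have hlim : ∃ l l', Tendsto f (𝓝[>] a) (𝓝 l) ∧ Tendsto f (𝓝[<] b) (𝓝 l') ∧
      (k * (b - a) ^ 2 = Real.pi ^ 2 → l = 0 ∧ l' = 0) := by
    rcases hlen.lt_or_eq with hlt | heq
    · obtain ⟨⟨l, hl⟩, l', hl'⟩ := exists_tendsto_endpoints_of_lt hab hlt d1 d2 hle f0
      exact ⟨l, l', hl, hl', fun h => absurd h hlt.ne⟩
    · obtain ⟨h1, h2⟩ := tendsto_endpoints_of_eq hab heq hic f0
      exact ⟨0, 0, h1, h2, fun _ => ⟨rfl, rfl⟩⟩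
  obtain ⟨l, l', hl, hl', hzero⟩ := hlim
  have tl : Tendsto h (𝓝[>] a) (𝓝 (l ^ (N - 1))) := by
    refine (hl.rpow_const (.inr hn.le)).congr' ?_
    filter_upwards [Ioo_mem_nhdsGT hab] with t ht using hpow t ht
  have tl' : Tendsto h (𝓝[<] b) (𝓝 (l' ^ (N - 1))) := by
    refine (hl'.rpow_const (.inr hn.le)).congr' ?_
    filter_upwards [Ioo_mem_nhdsLT hab] with t ht using hpow t ht
  set g := extendFrom (Ioo a b) h with hg
  have gc : ContinuousOn g (Icc a b) := continuousOn_Icc_extendFrom_Ioo hsmooth.continuousOn tl tl'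
  have ge : EqOn h g (Ioo a b) := fun t ht => (extendFrom_extends hsmooth.continuousOn t ht).symm
  have ga : g a = l ^ (N - 1) := eq_lim_at_left_extendFrom_Ioo hab tl
  have gb : g b = l' ^ (N - 1) := eq_lim_at_right_extendFrom_Ioo hab tl'
  have g0 : ∀ t ∈ Icc a b, 0 ≤ g t := by
    intro t ht
    rw [← closure_Ioo hab.ne] at ht gc
    exact le_on_closure (f := fun _ => (0 : ℝ)) (fun s hs => by rw [← ge hs]; exact h0 s hs)
      continuousOn_const gc ht
  refine ⟨hμ, g, densityMeasure_congr ge, g0, fun _ => ⟨gc, ?_⟩, fun h => absurd h hN.ne'⟩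
  have hgic : InterpConcave k (Icc a b) fun t => g t ^ (1 / (N - 1)) :=
    InterpConcave.Icc_of_Ioo hab (hic.congr fun t ht => by simp only [hf, ge ht])
      (continuousOn_rpow_one_div hN gc)
  refine hgic.weakConcave hN hab g0 hlen fun heq => ?_
  obtain ⟨rfl, rfl⟩ := hzero heq
  have e : ((0 : ℝ) ^ (N - 1)) ^ (1 / (N - 1)) = 0 := by
    rw [Real.zero_rpow hn.ne', Real.zero_rpow (one_div_pos.2 hn).ne']
  rw [ga, gb, e]
  exact ⟨rfl, rfl⟩

/-! ### The nonlinearity in the mean value constraint -/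

/-- The function `x |x|^{p-2}` whose mean value vanishes for competitors; the factor `x` makes it
vanish at `0` whatever the value of the power there. -/
noncomputable def signedPow (p x : ℝ) : ℝ := x * |x| ^ (p - 2)

lemma signedPow_eq {p : ℝ} (hp : 1 < p) (x : ℝ) :
    signedPow p x = max x 0 ^ (p - 1) - max (-x) 0 ^ (p - 1) := by
  have hp' : p - 1 ≠ 0 := by linarith
  have key : ∀ y : ℝ, 0 < y → y * y ^ (p - 2) = y ^ (p - 1) := by
    intro y hy
    have e : p - 1 = 1 + (p - 2) := by ring
    rw [e, Real.rpow_add hy, Real.rpow_one]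
  unfold signedPow
  rcases lt_trichotomy x 0 with h | rfl | h
  · rw [max_eq_right h.le, max_eq_left (by linarith), abs_of_neg h, Real.zero_rpow hp',
      ← key (-x) (by linarith)]
    ring
  · simp
  · rw [max_eq_left h.le, max_eq_right (by linarith), abs_of_pos h, Real.zero_rpow hp', key x h]
    ring

lemma continuous_signedPow {p : ℝ} (hp : 1 < p) : Continuous (signedPow p) := by
  have hp' : 0 ≤ p - 1 := by linarith
  rw [funext (signedPow_eq hp)]
  exact ((continuous_id.max continuous_const).rpow_const fun _ => .inr hp').sub
    ((continuous_neg.max continuous_const).rpow_const fun _ => .inr hp')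

lemma strictMono_signedPow {p : ℝ} (hp : 1 < p) : StrictMono (signedPow p) := by
  intro x y hxy
  have hp' : 0 < p - 1 := by linarith
  rw [signedPow_eq hp, signedPow_eq hp]
  have h1 : max x 0 ^ (p - 1) ≤ max y 0 ^ (p - 1) :=
    Real.rpow_le_rpow (le_max_right _ _) (max_le_max_right _ hxy.le) hp'.le
  have h2 : max (-y) 0 ^ (p - 1) ≤ max (-x) 0 ^ (p - 1) :=
    Real.rpow_le_rpow (le_max_right _ _) (max_le_max_right _ (by linarith)) hp'.le
  rcases lt_or_ge 0 y with hy | hy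
  · have : max x 0 ^ (p - 1) < max y 0 ^ (p - 1) :=
      Real.rpow_lt_rpow (le_max_right _ _) (max_lt (hxy.trans_le (le_max_left _ _))
        (hy.trans_le (le_max_left _ _))) hp'
    linarith
  · have : max (-y) 0 ^ (p - 1) < max (-x) 0 ^ (p - 1) :=
      Real.rpow_lt_rpow (le_max_right _ _) (max_lt (lt_of_lt_of_le (by linarith) (le_max_left _ _))
        (lt_of_lt_of_le (by linarith) (le_max_left _ _))) hp'
    linarith

lemma signedPow_zero (p : ℝ) : signedPow p 0 = 0 := by simp [signedPow]

/-! ### Measures with a bounded density on an interval -/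

lemma isFiniteMeasure_densityMeasure {a b M : ℝ} {h : ℝ → ℝ} (hM : ∀ t ∈ Icc a b, h t ≤ M) :
    IsFiniteMeasure (densityMeasure a b h) := by
  refine isFiniteMeasure_withDensity (ne_of_lt ?_)
  calc ∫⁻ t in Icc a b, ENNReal.ofReal (h t) ≤ ∫⁻ _ in Icc a b, ENNReal.ofReal M :=
        setLIntegral_mono' measurableSet_Icc fun t ht => ENNReal.ofReal_le_ofReal (hM t ht)
    _ < ⊤ := by
        rw [setLIntegral_const]
        exact ENNReal.mul_lt_top ENNReal.ofReal_lt_top measure_Icc_lt_top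

lemma ae_densityMeasure_mem (a b : ℝ) (h : ℝ → ℝ) : ∀ᵐ t ∂densityMeasure a b h, t ∈ Icc a b :=
  (withDensity_absolutelyContinuous _ _).ae_le (ae_restrict_mem measurableSet_Icc)

lemma lintegral_densityMeasure {a b : ℝ} {h : ℝ → ℝ} (hc : ContinuousOn h (Icc a b))
    {F : ℝ → ℝ≥0∞} (hF : Measurable F) :
    ∫⁻ t, F t ∂densityMeasure a b h = ∫⁻ t in Icc a b, ENNReal.ofReal (h t) * F t :=
  lintegral_withDensity_eq_lintegral_mul₀ (hc.aemeasurable measurableSet_Icc).ennreal_ofReal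
    hF.aemeasurable

lemma integral_densityMeasure {a b : ℝ} {h : ℝ → ℝ} (hc : ContinuousOn h (Icc a b))
    (h0 : ∀ t ∈ Icc a b, 0 ≤ h t) (F : ℝ → ℝ) :
    ∫ t, F t ∂densityMeasure a b h = ∫ t in Icc a b, h t * F t := by
  unfold densityMeasure
  rw [integral_withDensity_eq_integral_toReal_smul₀
    (hc.aemeasurable measurableSet_Icc).ennreal_ofReal (by simp)]
  refine setIntegral_congr_fun measurableSet_Icc fun t ht => ?_
  simp only [ENNReal.toReal_ofReal (h0 t ht), smul_eq_mul]

lemma rayleigh_smul {p : ℝ} {μ : Measure ℝ} {u : ℝ → ℝ} {c : ℝ≥0∞} (h0 : c ≠ 0) (ht : c ≠ ⊤) :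
    rayleigh p (c • μ) u = rayleigh p μ u := by
  unfold rayleigh
  rw [lintegral_smul_measure, lintegral_smul_measure, smul_eq_mul, smul_eq_mul,
    ENNReal.mul_div_mul_left _ _ h0 ht]

lemma Admissible.smul_measure {p : ℝ} {μ : Measure ℝ} {u : ℝ → ℝ} (hu : Admissible p μ u)
    {c : ℝ≥0∞} (h0 : c ≠ 0) (ht : c ≠ ⊤) : Admissible p (c • μ) u := by
  obtain ⟨hL, hm, hi, hne⟩ := hu
  refine ⟨hL, hm.smul_measure ht, by rw [integral_smul_measure, hi, smul_zero], fun h => hne ?_⟩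
  exact (Measure.absolutelyContinuous_smul h0).ae_le h

lemma eigenvalue_le_rayleigh {p : ℝ} {F : Set (Measure ℝ)} {μ : Measure ℝ} {u : ℝ → ℝ}
    (hμ : μ ∈ F) (hu : Admissible p μ u) : eigenvalue p F ≤ rayleigh p μ u :=
  iInf₂_le_of_le μ hμ (iInf₂_le u hu)

/-! ### Passage to the limit in the quotient -/

lemma tendsto_setLIntegral_density_mul {a b M C : ℝ} {H : ℕ → ℝ → ℝ} {h : ℝ → ℝ}
    (hHc : ∀ n, ContinuousOn (H n) (Icc a b)) (hHM : ∀ n, ∀ t ∈ Icc a b, H n t ≤ M)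
    (hlim : ∀ t ∈ Icc a b, Tendsto (fun n => H n t) atTop (𝓝 (h t)))
    {w : ℕ → ℝ → ℝ} {v : ℝ → ℝ} (hw : ∀ n, Measurable (w n)) (hwC : ∀ n, ∀ t ∈ Icc a b, w n t ≤ C)
    (hwlim : ∀ t ∈ Icc a b, Tendsto (fun n => w n t) atTop (𝓝 (v t))) :
    Tendsto (fun n => ∫⁻ t in Icc a b, ENNReal.ofReal (H n t) * ENNReal.ofReal (w n t)) atTop
      (𝓝 (∫⁻ t in Icc a b, ENNReal.ofReal (h t) * ENNReal.ofReal (v t))) := by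
  refine tendsto_lintegral_of_dominated_convergence'
    (fun _ => ENNReal.ofReal M * ENNReal.ofReal C) (fun n => ?_) (fun n => ?_) ?_ ?_
  · exact ((hHc n).aemeasurable measurableSet_Icc).ennreal_ofReal.mul
      (hw n).ennreal_ofReal.aemeasurable
  · filter_upwards [ae_restrict_mem measurableSet_Icc] with t ht
    exact mul_le_mul' (ENNReal.ofReal_le_ofReal (hHM n t ht))
      (ENNReal.ofReal_le_ofReal (hwC n t ht))
  · rw [setLIntegral_const]
    exact (ENNReal.mul_lt_top (ENNReal.mul_lt_top ENNReal.ofReal_lt_top ENNReal.ofReal_lt_top)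
      measure_Icc_lt_top).ne
  · filter_upwards [ae_restrict_mem measurableSet_Icc] with t ht
    exact ENNReal.Tendsto.mul (ENNReal.tendsto_ofReal (hlim t ht)) (.inr ENNReal.ofReal_ne_top)
      (ENNReal.tendsto_ofReal (hwlim t ht)) (.inr ENNReal.ofReal_ne_top)

/-- If the densities `H n` converge to `h`, then a competitor `u` for the limit measure can be
corrected by additive constants `κ n → 0` that restore the mean value constraint. -/
lemma exists_shift_tendsto_zero {p a b M B : ℝ} (hp : 1 < p) {H : ℕ → ℝ → ℝ} {h : ℝ → ℝ}
    (hHc : ∀ n, ContinuousOn (H n) (Icc a b))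
    (hHb : ∀ n, ∀ t ∈ Icc a b, 0 ≤ H n t ∧ H n t ≤ M)
    (hlim : ∀ t ∈ Icc a b, Tendsto (fun n => H n t) atTop (𝓝 (h t)))
    (hc : ContinuousOn h (Icc a b)) (hμ : IsProbabilityMeasure (densityMeasure a b h))
    {u : ℝ → ℝ} (hu : Continuous u) (huB : ∀ t ∈ Icc a b, |u t| ≤ B)
    (hu0 : ∫ t, signedPow p (u t) ∂densityMeasure a b h = 0) :
    ∃ κ : ℕ → ℝ, (∀ n, |κ n| ≤ B) ∧
      (∀ n, ∫ t, signedPow p (u t + κ n) ∂densityMeasure a b (H n) = 0) ∧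
      Tendsto κ atTop (𝓝 0) := by
  have hab : a ≤ b := by
    obtain ⟨x, hx, -⟩ := exists_pos_of_isProbabilityMeasure hμ
    exact (hx.1.trans hx.2).le
  have hB : 0 ≤ B := (abs_nonneg _).trans (huB a (left_mem_Icc.2 hab))
  have h0 : ∀ t ∈ Icc a b, 0 ≤ h t := fun t ht => ge_of_tendsto' (hlim t ht) fun n => (hHb n t ht).1
  have hM : 0 ≤ M := (hHb 0 a (left_mem_Icc.2 hab)).1.trans (hHb 0 a (left_mem_Icc.2 hab)).2
  have hs := continuous_signedPow hp
  have hsm := strictMono_signedPow hp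
  have hbound : ∀ r, ∃ C, ∀ κ ∈ Icc (-r) r, ∀ t ∈ Icc a b, |signedPow p (u t + κ)| ≤ C := by
    intro r
    obtain ⟨C, hC⟩ := (isCompact_Icc (a := -B - r) (b := B + r)).exists_bound_of_continuousOn
      hs.continuousOn
    refine ⟨C, fun κ hκ t ht => hC _ ?_⟩
    have h1 := abs_le.1 (huB t ht)
    exact ⟨by linarith [hκ.1], by linarith [hκ.2]⟩
  have hmeas : ∀ {g : ℝ → ℝ} (κ : ℝ), ContinuousOn g (Icc a b) →
      AEStronglyMeasurable (fun t => g t * signedPow p (u t + κ)) (volume.restrict (Icc a b)) :=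
    fun κ hg => (hg.mul (by fun_prop : Continuous fun t => signedPow p (u t + κ)).continuousOn
      ).aestronglyMeasurable measurableSet_Icc
  have hint : ∀ {g : ℝ → ℝ} (κ : ℝ), ContinuousOn g (Icc a b) →
      IntegrableOn (fun t => g t * signedPow p (u t + κ)) (Icc a b) :=
    fun κ hg => (hg.mul (by fun_prop : Continuous fun t => signedPow p (u t + κ)).continuousOn
      ).integrableOn_compact isCompact_Icc
  set Φ : ℕ → ℝ → ℝ := fun n κ => ∫ t in Icc a b, H n t * signedPow p (u t + κ) with hΦ
  set Φ' : ℝ → ℝ := fun κ => ∫ t in Icc a b, h t * signedPow p (u t + κ) with hΦ'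
  have hΦc : ∀ n, ContinuousOn (Φ n) (Icc (-B) B) := by
    intro n
    obtain ⟨C, hC⟩ := hbound B
    refine continuousOn_of_dominated (bound := fun _ => M * C) (fun κ _ => hmeas κ (hHc n))
      (fun κ hκ => ?_) (integrable_const _) ?_
    · filter_upwards [ae_restrict_mem measurableSet_Icc] with t ht
      rw [norm_mul, Real.norm_eq_abs, Real.norm_eq_abs, abs_of_nonneg (hHb n t ht).1]
      exact mul_le_mul (hHb n t ht).2 (hC κ hκ t ht) (abs_nonneg _) hM
    · exact ae_of_all _ fun t =>
        (by fun_prop : Continuous fun κ => H n t * signedPow p (u t + κ)).continuousOn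
  have hΦm : ∀ n, Monotone (Φ n) := fun n κ κ' hκ =>
    setIntegral_mono_on (hint κ (hHc n)) (hint κ' (hHc n)) measurableSet_Icc fun t ht =>
      mul_le_mul_of_nonneg_left (hsm.monotone (by linarith)) (hHb n t ht).1
  have hΦlim : ∀ κ, Tendsto (fun n => Φ n κ) atTop (𝓝 (Φ' κ)) := by
    intro κ
    obtain ⟨C, hC⟩ := hbound |κ|
    refine tendsto_integral_of_dominated_convergence (fun _ => M * C)
      (fun n => hmeas κ (hHc n)) (integrable_const _) (fun n => ?_) ?_
    · filter_upwards [ae_restrict_mem measurableSet_Icc] with t ht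
      rw [norm_mul, Real.norm_eq_abs, Real.norm_eq_abs, abs_of_nonneg (hHb n t ht).1]
      exact mul_le_mul (hHb n t ht).2 (hC κ ⟨neg_abs_le κ, le_abs_self κ⟩ t ht) (abs_nonneg _) hM
    · filter_upwards [ae_restrict_mem measurableSet_Icc] with t ht
      exact (hlim t ht).mul_const _
  have hΦ'sm : StrictMono Φ' := by
    intro κ κ' hκ
    have hfin := hμ
    have hi : ∀ κ, Integrable (fun t => signedPow p (u t + κ)) (densityMeasure a b h) := by
      intro κ
      obtain ⟨C, hC⟩ := hbound |κ|
      refine Integrable.of_bound (C := C)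
        (by fun_prop : Continuous fun t => signedPow p (u t + κ)).aestronglyMeasurable ?_
      filter_upwards [ae_densityMeasure_mem a b h] with t ht
        using hC κ ⟨neg_abs_le κ, le_abs_self κ⟩ t ht
    have hlt : ∀ t, signedPow p (u t + κ) < signedPow p (u t + κ') := fun t => hsm (by linarith)
    have hpos : 0 < ∫ t, (signedPow p (u t + κ') - signedPow p (u t + κ))
        ∂densityMeasure a b h := by
      rw [integral_pos_iff_support_of_nonneg (fun t => sub_nonneg.2 (hlt t).le)
        ((hi κ').sub (hi κ))]
      have : Function.support (fun t => signedPow p (u t + κ') - signedPow p (u t + κ)) = univ :=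
        eq_univ_of_forall fun t => (sub_pos.2 (hlt t)).ne'
      rw [this, measure_univ]
      exact one_pos
    rw [integral_sub (hi κ') (hi κ), integral_densityMeasure hc h0, integral_densityMeasure hc h0]
      at hpos
    exact sub_pos.1 hpos
  have hΦ'0 : Φ' 0 = 0 := by
    rw [integral_densityMeasure hc h0] at hu0
    simpa [hΦ'] using hu0
  have hex : ∀ n, ∃ κ ∈ Icc (-B) B, Φ n κ = 0 := by
    intro n
    refine intermediate_value_Icc (by linarith) (hΦc n) ⟨?_, ?_⟩
    · refine setIntegral_nonpos measurableSet_Icc fun t ht => ?_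
      refine mul_nonpos_of_nonneg_of_nonpos (hHb n t ht).1 ?_
      rw [← signedPow_zero p]
      exact hsm.monotone (by linarith [(abs_le.1 (huB t ht)).2])
    · refine setIntegral_nonneg measurableSet_Icc fun t ht => ?_
      refine mul_nonneg (hHb n t ht).1 ?_
      rw [← signedPow_zero p]
      exact hsm.monotone (by linarith [(abs_le.1 (huB t ht)).1])
  choose κ hκ hκ0 using hex
  refine ⟨κ, fun n => abs_le.2 (hκ n), fun n => ?_, ?_⟩
  · rw [integral_densityMeasure (hHc n) (fun t ht => (hHb n t ht).1)]
    exact hκ0 n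
  -- The zeros of the monotone functions `Φ n` converge to the only zero of their limit.
  · rw [tendsto_order]
    constructor
    · intro δ hδ
      have h1 : Φ' δ < 0 := by rw [← hΦ'0]; exact hΦ'sm hδ
      filter_upwards [(hΦlim δ).eventually_lt_const h1] with n hn
      by_contra! h2
      exact absurd (hΦm n h2) (by rw [hκ0 n]; exact not_le.2 hn)
    · intro δ hδ
      have h1 : 0 < Φ' δ := by rw [← hΦ'0]; exact hΦ'sm hδ
      filter_upwards [(hΦlim δ).eventually_const_lt h1] with n hn
      by_contra! h2
      exact absurd (hΦm n h2) (by rw [hκ0 n]; exact not_le.2 hn)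

/-- The quotient of a competitor for a limit of densities is a limit of quotients of competitors
for the approximating densities. -/
lemma eigenvalue_le_rayleigh_of_tendsto {p a b M : ℝ} (hp : 1 < p) {F : Set (Measure ℝ)}
    {H : ℕ → ℝ → ℝ} {h : ℝ → ℝ} (hHc : ∀ n, ContinuousOn (H n) (Icc a b))
    (hHb : ∀ n, ∀ t ∈ Icc a b, 0 ≤ H n t ∧ H n t ≤ M)
    (hlim : ∀ t ∈ Icc a b, Tendsto (fun n => H n t) atTop (𝓝 (h t)))
    (hc : ContinuousOn h (Icc a b)) (hμ : IsProbabilityMeasure (densityMeasure a b h))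
    (hF : ∀ n, ∃ c : ℝ≥0∞, c ≠ 0 ∧ c ≠ ⊤ ∧ c • densityMeasure a b (H n) ∈ F)
    {u : ℝ → ℝ} (hu : Admissible p (densityMeasure a b h) u) :
    eigenvalue p F ≤ rayleigh p (densityMeasure a b h) u := by
  obtain ⟨⟨L, hL⟩, -, hu0, hune⟩ := hu
  have hp0 : 0 ≤ p := by linarith
  have huc := hL.continuous
  obtain ⟨B, hB⟩ := (isCompact_Icc (a := a) (b := b)).exists_bound_of_continuousOn
    huc.continuousOn
  obtain ⟨κ, hκB, hκ, hκlim⟩ := exists_shift_tendsto_zero hp hHc hHb hlim hc hμ huc hB hu0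
  have hBκ : ∀ n, ∀ t ∈ Icc a b, |u t + κ n| ≤ B + B := fun n t ht =>
    (abs_add_le _ _).trans (add_le_add (hB t ht) (hκB n))
  have hder : ∀ t, |deriv u t| ≤ L := fun t => norm_deriv_le_of_lipschitz hL
  have mnum : Measurable fun t => |deriv u t| ^ p := ((measurable_deriv u).norm.pow_const p :)
  have mden : ∀ c : ℝ, Measurable fun t => |u t + c| ^ p := fun c =>
    ((huc.add continuous_const).abs.rpow_const fun _ => .inr hp0).measurable
  have tnum := tendsto_setLIntegral_density_mul hHc (fun n t ht => (hHb n t ht).2) hlim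
    (w := fun _ t => |deriv u t| ^ p) (v := fun t => |deriv u t| ^ p) (C := (L : ℝ) ^ p)
    (fun _ => mnum) (fun _ t _ => Real.rpow_le_rpow (abs_nonneg _) (hder t) hp0)
    (fun t _ => tendsto_const_nhds)
  have tden := tendsto_setLIntegral_density_mul hHc (fun n t ht => (hHb n t ht).2) hlim
    (w := fun n t => |u t + κ n| ^ p) (v := fun t => |u t| ^ p) (C := (B + B) ^ p)
    (fun n => mden (κ n)) (fun n t ht => Real.rpow_le_rpow (abs_nonneg _) (hBκ n t ht) hp0)
    (fun t _ => by
      have h1 : Tendsto (fun n => u t + κ n) atTop (𝓝 (u t)) := by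
        simpa using hκlim.const_add (u t)
      exact h1.abs.rpow_const (.inr hp0))
  simp only [← lintegral_densityMeasure (hHc _) mnum.ennreal_ofReal] at tnum
  simp only [← lintegral_densityMeasure (hHc _) (mden _).ennreal_ofReal] at tden
  have mden0 : Measurable fun t => |u t| ^ p := by simpa using mden 0
  rw [← lintegral_densityMeasure hc mnum.ennreal_ofReal] at tnum
  rw [← lintegral_densityMeasure hc mden0.ennreal_ofReal] at tden
  have hden : ∫⁻ t, ENNReal.ofReal (|u t| ^ p) ∂densityMeasure a b h ≠ 0 := by
    intro hz
    rw [lintegral_eq_zero_iff mden0.ennreal_ofReal] at hz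
    refine hune ?_
    filter_upwards [hz] with t ht
    have h1 : |u t| ^ p ≤ 0 := ENNReal.ofReal_eq_zero.1 ht
    by_contra hne
    exact absurd (Real.rpow_pos_of_pos (abs_pos.2 hne) p) (not_lt.2 h1)
  have hnum : ∫⁻ t, ENNReal.ofReal (|deriv u t| ^ p) ∂densityMeasure a b h ≠ ⊤ := by
    refine ne_top_of_le_ne_top (b := ∫⁻ _, ENNReal.ofReal ((L : ℝ) ^ p) ∂densityMeasure a b h)
      (by simp) (lintegral_mono fun t => ?_)
    exact ENNReal.ofReal_le_ofReal (Real.rpow_le_rpow (abs_nonneg _) (hder t) hp0)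
  refine ge_of_tendsto (ENNReal.Tendsto.div tnum (.inr hden) tden (.inr hnum)) ?_
  filter_upwards [tden.eventually_ne hden] with n hn
  obtain ⟨c, hc0, hct, hcF⟩ := hF n
  have hfin := isFiniteMeasure_densityMeasure fun t ht => (hHb n t ht).2
  have hadm : Admissible p (densityMeasure a b (H n)) fun t => u t + κ n := by
    refine ⟨⟨L + 0, hL.add (LipschitzWith.const (κ n))⟩, ?_, hκ n, fun hz => hn ?_⟩
    · refine MemLp.of_bound (huc.add continuous_const).aestronglyMeasurable (B + B) ?_
      filter_upwards [ae_densityMeasure_mem a b (H n)] with t ht using hBκ n t ht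
    · rw [lintegral_eq_zero_iff (mden _).ennreal_ofReal]
      filter_upwards [hz] with t ht
      have h1 : u t + κ n = 0 := ht
      simp [h1, Real.zero_rpow (by linarith : p ≠ 0)]
  refine (eigenvalue_le_rayleigh hcF (hadm.smul_measure hc0 hct)).trans (le_of_eq ?_)
  rw [rayleigh_smul hc0 hct]
  simp only [rayleigh, deriv_add_const]

/-! ### Comparison of the two classes -/

lemma mem_smoothOn_of_root {K N a b : ℝ} (hN : 1 < N) {h g : ℝ → ℝ}
    (hμ : IsProbabilityMeasure (densityMeasure a b h)) (h0 : ∀ t ∈ Ioo a b, 0 ≤ h t)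
    (hg : EqOn (fun t => h t ^ (1 / (N - 1))) g (Ioo a b)) (hpos : ∀ t ∈ Ioo a b, 0 < g t)
    (hg2 : ContDiffOn ℝ 2 g (Ioo a b))
    (hle : ∀ t ∈ Ioo a b, deriv (deriv g) t + K / (N - 1) * g t ≤ 0) :
    densityMeasure a b h ∈ smoothOn K N a b := by
  have hroot : EqOn h (fun t => g t ^ (N - 1)) (Ioo a b) := fun t ht => by
    simp only [← hg ht, rpow_rpow_inv_of_nonneg hN (h0 t ht)]
  have hd1 : EqOn (deriv fun t => h t ^ (1 / (N - 1))) (deriv g) (Ioo a b) := fun t ht =>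
    (hg.eventuallyEq_of_mem (isOpen_Ioo.mem_nhds ht)).deriv_eq
  have hd2 : EqOn (deriv (deriv fun t => h t ^ (1 / (N - 1)))) (deriv (deriv g)) (Ioo a b) :=
    fun t ht => (hd1.eventuallyEq_of_mem (isOpen_Ioo.mem_nhds ht)).deriv_eq
  have hg1 : ContDiffOn ℝ 1 (deriv g) (Ioo a b) :=
    hg2.deriv_of_isOpen isOpen_Ioo (by norm_num)
  refine ⟨hμ, h, rfl, h0, fun _ => ⟨?_, ?_, ?_, fun t ht => ?_⟩, fun h => absurd h hN.ne'⟩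
  · exact (hg2.rpow_const_of_ne fun t ht => (hpos t ht).ne').congr hroot
  · exact (hg2.differentiableOn (by norm_num)).congr hg
  · exact (hg1.differentiableOn (by norm_num)).congr hd1
  · have h1 : h t ^ (1 / (N - 1)) = g t := hg ht
    rw [hd2 ht, h1]
    exact hle t ht

/-- Normalizing the measure multiplies the root of the density by a constant, which the linear
differential inequality does not see. -/
lemma exists_smul_mem_smoothOn {K N a b : ℝ} (hN : 1 < N) (hab : a < b) {G : ℝ → ℝ}
    (hc : ContinuousOn G (Icc a b)) (hpos : ∀ t ∈ Ioo a b, 0 < G t)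
    (hG : ContDiffOn ℝ 2 G (Ioo a b))
    (hle : ∀ t ∈ Ioo a b, deriv (deriv G) t + K / (N - 1) * G t ≤ 0) :
    ∃ c : ℝ≥0∞, c ≠ 0 ∧ c ≠ ⊤ ∧
      c • densityMeasure a b (fun t => G t ^ (N - 1)) ∈ smoothOn K N a b := by
  have hn : 0 < N - 1 := by linarith
  set h : ℝ → ℝ := fun t => G t ^ (N - 1) with hh
  have hhc : ContinuousOn h (Icc a b) := hc.rpow_const fun _ _ => .inr hn.le
  obtain ⟨M, hM⟩ := (isCompact_Icc (a := a) (b := b)).exists_bound_of_continuousOn hhc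
  have hfin : IsFiniteMeasure (densityMeasure a b h) :=
    isFiniteMeasure_densityMeasure fun t ht => (le_abs_self _).trans (hM t ht)
  have hne : densityMeasure a b h univ ≠ 0 := by
    rw [Measure.measure_univ_ne_zero]
    intro hz
    have h1 : ∫⁻ _, 1 ∂densityMeasure a b h = 0 := by simp [hz]
    rw [lintegral_densityMeasure hhc measurable_const] at h1
    simp only [mul_one] at h1
    rw [lintegral_eq_zero_iff' (hhc.aemeasurable measurableSet_Icc).ennreal_ofReal,
      ← restrict_Ioo_eq_restrict_Icc] at h1
    have h2 : ∀ᵐ t ∂volume.restrict (Ioo a b), False := by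
      filter_upwards [h1, ae_restrict_mem measurableSet_Ioo] with t ht htI
      exact absurd (Real.rpow_pos_of_pos (hpos t htI) (N - 1))
        (not_lt.2 (ENNReal.ofReal_eq_zero.1 ht))
    have h3 : volume.restrict (Ioo a b) = 0 := by
      rw [← ae_eq_bot]
      exact Filter.eventually_false_iff_eq_bot.1 h2
    rw [Measure.restrict_eq_zero, Real.volume_Ioo] at h3
    exact absurd (ENNReal.ofReal_eq_zero.1 h3) (by linarith)
  set c : ℝ≥0∞ := (densityMeasure a b h univ)⁻¹ with hcdef
  have hc0 : c ≠ 0 := ENNReal.inv_ne_zero.2 (measure_ne_top _ _)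
  have hct : c ≠ ⊤ := ENNReal.inv_ne_top.2 hne
  have hcpos : 0 < c.toReal := ENNReal.toReal_pos hc0 hct
  refine ⟨c, hc0, hct, ?_⟩
  have hsmul : c • densityMeasure a b h = densityMeasure a b fun t => c.toReal * h t := by
    unfold densityMeasure
    rw [← withDensity_smul' _ _ hct]
    congr 1
    funext t
    rw [ENNReal.ofReal_mul hcpos.le, ENNReal.ofReal_toReal hct]
    rfl
  have hprob : IsProbabilityMeasure (c • densityMeasure a b h) :=
    ⟨by simp [hcdef, ENNReal.inv_mul_cancel hne (measure_ne_top _ _)]⟩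
  rw [hsmul] at hprob ⊢
  have hd : 0 < c.toReal ^ (1 / (N - 1)) := Real.rpow_pos_of_pos hcpos _
  have hh0 : ∀ t ∈ Ioo a b, 0 ≤ h t := fun t ht => Real.rpow_nonneg (hpos t ht).le _
  refine mem_smoothOn_of_root (g := fun t => c.toReal ^ (1 / (N - 1)) * G t) hN hprob
    (fun t ht => mul_nonneg hcpos.le (hh0 t ht)) (fun t ht => ?_)
    (fun t ht => mul_pos hd (hpos t ht)) (contDiffOn_const.mul hG) (fun t ht => ?_)
  · simp only [hh]
    rw [Real.mul_rpow hcpos.le (hh0 t ht), ← Real.rpow_mul (hpos t ht).le,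
      mul_one_div_cancel hn.ne', Real.rpow_one]
  · have e1 : deriv (fun t => c.toReal ^ (1 / (N - 1)) * G t)
        = fun t => c.toReal ^ (1 / (N - 1)) * deriv G t := funext fun t => by simp
    have e2 : deriv (deriv fun t => c.toReal ^ (1 / (N - 1)) * G t) t
        = c.toReal ^ (1 / (N - 1)) * deriv (deriv G) t := by rw [e1]; simp
    rw [e2]
    have := mul_nonpos_of_nonneg_of_nonpos hd.le (hle t ht)
    linarith

/-- The smooth class is dense in the synthetic class as far as the quotients are concerned. -/
lemma eigenvalue_smoothOn_le_rayleigh {p K N a b : ℝ} (hp : 1 < p) (hN : 1 ≤ N) (hab : a < b)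
    {μ : Measure ℝ} (hμ : μ ∈ syntheticOn K N a b) {u : ℝ → ℝ} (hu : Admissible p μ u) :
    eigenvalue p (smoothOn K N a b) ≤ rayleigh p μ u := by
  obtain ⟨hprob, h, rfl, h0, hsyn, hone⟩ := hμ
  rcases hN.eq_or_lt with rfl | hN
  · obtain ⟨c, hc⟩ := hone rfl
    refine eigenvalue_le_rayleigh ?_ hu
    exact ⟨hprob, h, rfl, fun t ht => h0 t (Ioo_subset_Icc_self ht), fun h => absurd h (lt_irrefl _),
      fun _ => ⟨c, fun t ht => hc t (Ioo_subset_Icc_self ht)⟩⟩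
  obtain ⟨hcont, hweak⟩ := hsyn hN
  have hn : 0 < N - 1 := by linarith
  set f : ℝ → ℝ := fun t => h t ^ (1 / (N - 1)) with hf
  have hic : InterpConcave (K / (N - 1)) (Icc a b) f := hweak.interpConcave hN h0
  have hicO := hic.mono Ioo_subset_Icc_self
  have f0 : ∀ t ∈ Icc a b, 0 ≤ f t := fun t ht => Real.rpow_nonneg (h0 t ht) _
  have f0' : ∀ t ∈ Ioo a b, 0 ≤ f t := fun t ht => f0 t (Ioo_subset_Icc_self ht)
  have hfc : ContinuousOn f (Icc a b) := continuousOn_rpow_one_div hN hcont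
  obtain ⟨x, hx, hxpos⟩ := exists_pos_of_isProbabilityMeasure hprob
  have fpos : ∀ t ∈ Ioo a b, 0 < f t := fun t ht =>
    hicO.pos_of_pos f0' hx ht (Real.rpow_pos_of_pos hxpos _)
  have hpow : ∀ t ∈ Icc a b, f t ^ (N - 1) = h t := fun t ht => rpow_rpow_inv_of_nonneg hN (h0 t ht)
  rcases (hicO.length_le (hfc.mono Ioo_subset_Icc_self) fpos hab).lt_or_eq with hk | hk
  · obtain ⟨G, M, hGc, hGb, hGpos, hG2, hGle, hGlim⟩ :=
      hic.exists_smooth_approximation hab hk hfc f0 fpos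
    refine eigenvalue_le_rayleigh_of_tendsto (H := fun n t => G n t ^ (N - 1)) (M := M ^ (N - 1)) hp
      (fun n => (hGc n).rpow_const fun _ _ => .inr hn.le) (fun n t ht => ?_) (fun t ht => ?_)
      hcont hprob (fun n => exists_smul_mem_smoothOn hN hab (hGc n) (hGpos n) (hG2 n) (hGle n)) hu
    · obtain ⟨h1, h2⟩ := hGb n t ht
      exact ⟨Real.rpow_nonneg h1 _, Real.rpow_le_rpow h1 h2 hn.le⟩
    · rw [← hpow t ht]
      exact (hGlim t ht).rpow_const (.inr hn.le)
  -- On an interval of the maximal length the density is already smooth.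
  · obtain ⟨c, hc⟩ := hicO.eq_const_mul_sn hab hk f0'
    refine eigenvalue_le_rayleigh (mem_smoothOn_of_root (g := fun t => c * sn (K / (N - 1)) (t - a))
      hN hprob (fun t ht => h0 t (Ioo_subset_Icc_self ht)) hc
      (fun t ht => by rw [← hc t ht]; exact fpos t ht) ?_ (fun t _ => le_of_eq ?_)) hu
    · exact (contDiff_const.mul
        ((contDiff_sn _).comp (contDiff_id.sub contDiff_const))).contDiffOn
    · have e1 : deriv (fun t => c * sn (K / (N - 1)) (t - a))
          = fun t => c * cs (K / (N - 1)) (t - a) :=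
        funext fun t => ((hasDerivAt_sn_sub _ a t).const_mul c).deriv
      rw [e1, ((hasDerivAt_cs_sub _ a t).const_mul c).deriv]
      ring

lemma eigenvalue_anti {p : ℝ} {F F' : Set (Measure ℝ)} (h : F ⊆ F') :
    eigenvalue p F' ≤ eigenvalue p F := biInf_mono h

lemma eigenvalue_syntheticOn_eq {p K N a b : ℝ} (hp : 1 < p) (hN : 1 ≤ N) (hab : a < b) :
    eigenvalue p (syntheticOn K N a b) = eigenvalue p (smoothOn K N a b) :=
  le_antisymm (eigenvalue_anti (smoothOn_subset_syntheticOn hN hab))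
    (le_iInf₂ fun _ hμ => le_iInf₂ fun _ hu => eigenvalue_smoothOn_le_rayleigh hp hN hab hμ hu)

end ModelGap

theorem propositionP (p N K D : ℝ) (hp : 1 < p) (hN : 1 ≤ N) (hD : 0 < D) :
    ModelGap.eigenvalue p (ModelGap.synthetic K N D)
        = ModelGap.eigenvalue p (ModelGap.smooth K N D) ∧
      ModelGap.eigenvalue p (ModelGap.syntheticOn K N 0 D)
        = ModelGap.eigenvalue p (ModelGap.smoothOn K N 0 D) := by
  refine ⟨le_antisymm (ModelGap.eigenvalue_anti ?_) ?_, ModelGap.eigenvalue_syntheticOn_eq hp hN hD⟩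
  · rintro μ ⟨a, b, ha, hab, hb, hμ⟩
    exact ⟨a, b, ha, hab, hb, ModelGap.smoothOn_subset_syntheticOn hN hab hμ⟩
  · refine le_iInf₂ fun μ hμ => le_iInf₂ fun u hu => ?_
    obtain ⟨a, b, ha, hab, hb, hμ⟩ := hμ
    refine le_trans (ModelGap.eigenvalue_anti ?_)
      (ModelGap.eigenvalue_smoothOn_le_rayleigh hp hN hab hμ hu)
    exact fun ν hν => ⟨a, b, ha, hab, hb, hν⟩
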